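/- Let $p$ be a prime, let $\mathbf a_1,\dots,\mathbf a_r\in\mathbb Z_{\ge 0}^n$, and let $H\subseteq\mathbb Z_{\ge 0}^n$ be the submonoid they generate. Fix $p^{1/p^i}\in\overline{\mathbb Q_p}$ ($i\ge 0$) with $p^{1/p^0}=p$ and $(p^{1/p^{i+1}})^p=p^{1/p^i}$, and let $H^{1/p^i}\subseteq(\tfrac1{p^i}\mathbb Z_{\ge0})^n$ be the submonoid generated by $\mathbf a_1/p^i,\dots,\mathbf a_r/p^i$. For a ring $S$ let $S[[H^{1/p^i}]]$ denote the $(p,\mathbf t^{\mathbf a_1/p^i},\dots,\mathbf t^{\mathbf a_r/p^i})$-adic completion of the monoid algebra $S[H^{1/p^i}]$; for $i=0$ write $S[[H]]$. (1) $\mathbb Z_p[H]$ is (via $\mathbf t^h\mapsto\mathbf t^h$) the $\mathbb Z_p$-subalgebra of $\mathbb Z_p[t_1,\dots,t_n]$ generated by $\mathbf t^{\mathbf a_1},\dots,\mathbf t^{\mathbf a_r}$. It is a $p$-torsion-free finitely generated $\mathbb Z_p$-algebra, and the $\mathbb Z_p$-linear map $\mathbf t^h\mapsto\mathbf t^{ph}$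 is a ring endomorphism lifting the Frobenius modulo $p$. (2) The ring $R=\mathbb Z_p[[H]]$ is $p$-torsion-free, $p$-Zariskian (that is, $p$ lies in its Jacobson radical) and $p$-adically separated, $R/pR$ is reduced, and the endomorphism $\varphi$ of $R$ induced by $\mathbf t^h\mapsto\mathbf t^{ph}$ is the Frobenius lift $\varphi(x)=x^p+p\,\delta(x)$ of a $\delta$-structure on $R$. (3) The tower $$\mathbb Z_p[[H]]\hookrightarrow\mathbb Z_p[p^{1/p}][[H^{1/p}]]\hookrightarrow\cdots\hookrightarrow\mathbb Z_p[p^{1/p^i}][[H^{1/p^i}]]\hookrightarrow\cdots,$$ whose transition maps are induced by the inclusions and are injective, is a perfectoid tower arising from $(\mathbb Z_p[[H]],(p))$. (4) Its tilt is isomorphic, as a tower of rings, to $$\mathbb F_p[[H]][[T]]\hookrightarrow\mathbb F_p[[H^{1/p}]][[T]]\hookrightarrow\cdots\hookrightarrow\mathbb F_p[[H^{1/p^i}]][[T]]\hookrightarrow\cdots,$$ where the (injective) transition maps are the inclusions on the coefficient rings and send $T$ to $T^p$ (the variable $T$ of the $i$-th term stands for $T^{1/p^i}$). Here a tower of rings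 $R_0\xrightarrow{\iota_0} R_1\xrightarrow{\iota_1}\cdots$ is a perfectoid tower arising from $(R,I_0)$ if: (a) $R_0\cong R$ (here through the canonical map) and $p\in I_0$; (b) the induced maps $\overline{\iota_i}\colon R_i/I_0R_i\to R_{i+1}/I_0R_{i+1}$ are injective; (c) the Frobenius of $R_{i+1}/I_0R_{i+1}$ has image in that of $\overline{\iota_i}$, hence factors as $\overline{\iota_i}\circ F_i$ for a unique $F_i\colon R_{i+1}/I_0R_{i+1}\to R_i/I_0R_i$; (d) each $F_i$ is surjective; (e) $I_0R_i$ lies in the Jacobson radical of $R_i$; (f) $I_0$ is principal and there is a principal ideal $I_1\subseteq R_1$ such that the $p$-th powers of its elements generate $I_0R_1$ and, for all $i\ge0$, $\ker F_i$ is generated by the image of $I_1$; (g) every $I_0$-power-torsion element of $R_i$ is $I_0$-torsion, and there are bijections $R_{i+1}[I_0^\infty]\to R_i[I_0^\infty]$ compatible with $F_i$. The tilt of such a tower is the tower with terms $\varprojlim\bigl(\cdots\xrightarrow{F_{i+1}}R_{i+1}/I_0R_{i+1}\xrightarrow{F_i}R_i/I_0R_i\bigr)$ and transition maps induced by the $\overline{\iota_{i+k}}$,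 $k\ge0$. -/

import Mathlib

noncomputable section

/-! ### Towers of rings -/

universe u v

/-- A tower of commutative rings `A₀ → A₁ → A₂ → ⋯`. -/
structure RingTower where
  /-- the terms of the tower -/
  obj : ℕ → Type u
  [commRing : ∀ i, CommRing (obj i)]
  /-- the transition maps of the tower -/
  map : ∀ i, obj i →+* obj (i + 1)

attribute [instance] RingTower.commRing

namespace RingTower

/-- The composite transition map `A₀ → A_i`. -/
def fromZero (T : RingTower.{u}) : ∀ i, T.obj 0 →+* T.obj i
  | 0 => RingHom.id _
  | i + 1 => (T.map i).comp (T.fromZero i)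

/-- The composite transition map `A₁ → A_{i+1}`. -/
def fromOne (T : RingTower.{u}) : ∀ i, T.obj 1 →+* T.obj (i + 1)
  | 0 => RingHom.id _
  | i + 1 => (T.map (i + 1)).comp (T.fromOne i)

/-- Two towers of rings are isomorphic: there are ring isomorphisms of the terms that commute
with the transition maps. -/
def IsIsomorphic (T : RingTower.{u}) (T' : RingTower.{v}) : Prop :=
  ∃ f : ∀ i, T.obj i ≃+* T'.obj i, ∀ i (x : T.obj i), f (i + 1) (T.map i x) = T'.map i (f i x)

variable {R : Type v} [CommRing R]

/-- The ideal `I₀ R_i` of the `i`-th term, where `e : R → R₀` is the structure map. -/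
def baseIdeal (T : RingTower.{u}) (e : R →+* T.obj 0) (I₀ : Ideal R) (i : ℕ) :
    Ideal (T.obj i) :=
  I₀.map ((T.fromZero i).comp e)

theorem baseIdeal_le_comap (T : RingTower.{u}) (e : R →+* T.obj 0) (I₀ : Ideal R) (i : ℕ) :
    T.baseIdeal e I₀ i ≤ (T.baseIdeal e I₀ (i + 1)).comap (T.map i) := by
  unfold baseIdeal
  rw [Ideal.map_le_iff_le_comap]
  intro x hx
  exact Ideal.mem_map_of_mem ((T.fromZero (i + 1)).comp e) hx

/-- The quotient `R_i / I₀ R_i`. -/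
abbrev Quot (T : RingTower.{u}) (e : R →+* T.obj 0) (I₀ : Ideal R) (i : ℕ) : Type u :=
  T.obj i ⧸ T.baseIdeal e I₀ i

/-- The map `R_i / I₀ R_i → R_{i+1} / I₀ R_{i+1}` induced by the transition map. -/
def quotMap (T : RingTower.{u}) (e : R →+* T.obj 0) (I₀ : Ideal R) (i : ℕ) :
    T.Quot e I₀ i →+* T.Quot e I₀ (i + 1) :=
  Ideal.quotientMap _ (T.map i) (T.baseIdeal_le_comap e I₀ i)

/-- `T` is a `p`-purely inseparable tower arising from `(R, I₀)`, the isomorphism `R ≅ R₀` being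
`e`. -/
structure IsPurelyInseparable (p : ℕ) (T : RingTower.{u}) (e : R →+* T.obj 0) (I₀ : Ideal R) :
    Prop where
  bijective : Function.Bijective e
  p_mem : (p : R) ∈ I₀
  quotMap_injective : ∀ i, Function.Injective (T.quotMap e I₀ i)
  frobenius_mem : ∀ i (x : T.Quot e I₀ (i + 1)), ∃ y, T.quotMap e I₀ i y = x ^ p

section FrobeniusProjection

variable {p : ℕ} {T : RingTower.{u}} {e : R →+* T.obj 0} {I₀ : Ideal R}

theorem IsPurelyInseparable.p_eq_zero (h : IsPurelyInseparable p T e I₀) (i : ℕ) :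
    (p : T.Quot e I₀ i) = 0 := by
  have h1 : ((T.fromZero i).comp e) (p : R) ∈ T.baseIdeal e I₀ i :=
    Ideal.mem_map_of_mem _ h.p_mem
  rw [map_natCast] at h1
  have h2 := Ideal.Quotient.eq_zero_iff_mem.mpr h1
  rwa [map_natCast] at h2

/-- The underlying function of the Frobenius projection. -/
def IsPurelyInseparable.frobFun (h : IsPurelyInseparable p T e I₀) (i : ℕ)
    (x : T.Quot e I₀ (i + 1)) : T.Quot e I₀ i :=
  Classical.choose (h.frobenius_mem i x)

theorem IsPurelyInseparable.quotMap_frobFun (h : IsPurelyInseparable p T e I₀) (i : ℕ)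
    (x : T.Quot e I₀ (i + 1)) : T.quotMap e I₀ i (h.frobFun i x) = x ^ p :=
  Classical.choose_spec (h.frobenius_mem i x)

/-- The `i`-th Frobenius projection `F_i : R_{i+1} / I₀ R_{i+1} → R_i / I₀ R_i`, the unique map
whose composite with `R_i / I₀ R_i → R_{i+1} / I₀ R_{i+1}` is the Frobenius map. -/
def IsPurelyInseparable.frobProj [Fact p.Prime] (h : IsPurelyInseparable p T e I₀) (i : ℕ) :
    T.Quot e I₀ (i + 1) →+* T.Quot e I₀ i where
  toFun := h.frobFun i
  map_one' := h.quotMap_injective i (by rw [h.quotMap_frobFun, map_one, one_pow])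
  map_mul' x y := h.quotMap_injective i (by
    rw [map_mul, h.quotMap_frobFun, h.quotMap_frobFun, h.quotMap_frobFun, mul_pow])
  map_zero' := h.quotMap_injective i (by
    rw [h.quotMap_frobFun, map_zero, zero_pow (Fact.out : p.Prime).ne_zero])
  map_add' x y := h.quotMap_injective i (by
    rw [map_add, h.quotMap_frobFun, h.quotMap_frobFun, h.quotMap_frobFun]
    obtain ⟨c, hc⟩ := exists_add_pow_prime_eq (Fact.out : p.Prime) x y
    rw [hc, h.p_eq_zero]
    ring)

theorem IsPurelyInseparable.quotMap_frobProj [Fact p.Prime] (h : IsPurelyInseparable p T e I₀)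
    (i : ℕ) (x : T.Quot e I₀ (i + 1)) : T.quotMap e I₀ i (h.frobProj i x) = x ^ p :=
  h.quotMap_frobFun i x

theorem IsPurelyInseparable.frobProj_quotMap [Fact p.Prime] (h : IsPurelyInseparable p T e I₀)
    (i : ℕ) (x : T.Quot e I₀ i) : h.frobProj i (T.quotMap e I₀ i x) = x ^ p :=
  h.quotMap_injective i (by rw [h.quotMap_frobProj, map_pow])

end FrobeniusProjection

end RingTower

/-- The ideal `I^{[p]}` generated by the `p`-th powers of the elements of `I`. -/
def Ideal.frobeniusPower {A : Type*} [CommRing A] (I : Ideal A) (p : ℕ) : Ideal A :=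
  Ideal.span {y | ∃ x ∈ I, y = x ^ p}

/-- The `I`-torsion elements of the ring. -/
def Ideal.torsionElements {A : Type*} [CommRing A] (I : Ideal A) : Set A :=
  {x | ∀ y ∈ I, y * x = 0}

/-- The `I`-power-torsion elements of the ring. -/
def Ideal.powerTorsionElements {A : Type*} [CommRing A] (I : Ideal A) : Set A :=
  {x | ∃ k : ℕ, ∀ y ∈ I ^ k, y * x = 0}

/-- A ring `A` is `I`-Zariskian if `I` is contained in the Jacobson radical of `A`. -/
def Ideal.IsZariskian {A : Type*} [CommRing A] (I : Ideal A) : Prop :=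
  I ≤ Ideal.jacobson ⊥

namespace RingTower

variable {R : Type v} [CommRing R]

/-- `T` is a perfectoid tower arising from `(R, I₀)`, the isomorphism `R ≅ R₀` being `e`. -/
structure IsPerfectoid (p : ℕ) [Fact p.Prime] (T : RingTower.{u}) (e : R →+* T.obj 0)
    (I₀ : Ideal R) : Prop extends IsPurelyInseparable p T e I₀ where
  frobProj_surjective : ∀ i, Function.Surjective (toIsPurelyInseparable.frobProj i)
  zariskian : ∀ i, (T.baseIdeal e I₀ i).IsZariskian
  principal : I₀.IsPrincipal
  pillar : ∃ I₁ : Ideal (T.obj 1), I₁.IsPrincipal ∧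
    I₁.frobeniusPower p = T.baseIdeal e I₀ 1 ∧
    ∀ i, RingHom.ker (toIsPurelyInseparable.frobProj i) =
      I₁.map ((Ideal.Quotient.mk (T.baseIdeal e I₀ (i + 1))).comp (T.fromOne i))
  torsion : ∀ i, (T.baseIdeal e I₀ i).powerTorsionElements =
    (T.baseIdeal e I₀ i).torsionElements
  torsion_frobenius : ∀ i, ∃ f : (T.baseIdeal e I₀ (i + 1)).powerTorsionElements →
      (T.baseIdeal e I₀ i).powerTorsionElements,
    Function.Bijective f ∧ ∀ x,
      (Ideal.Quotient.mk (T.baseIdeal e I₀ i) (f x) : T.Quot e I₀ i) =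
        toIsPurelyInseparable.frobProj i (Ideal.Quotient.mk _ (x : T.obj (i + 1)))

section Tilt

variable {p : ℕ} [Fact p.Prime] {T : RingTower.{u}} {e : R →+* T.obj 0} {I₀ : Ideal R}

/-- The `i`-th small tilt, the inverse limit of
`⋯ → R_{i+2} / I₀ R_{i+2} → R_{i+1} / I₀ R_{i+1} → R_i / I₀ R_i` along the Frobenius projections.
Its elements are the families `(x_m)_{m ≥ i}` with `F_m (x_{m+1}) = x_m`. -/
def IsPurelyInseparable.smallTilt (h : IsPurelyInseparable p T e I₀) (i : ℕ) :
    Subring (∀ m : {m : ℕ // i ≤ m}, T.Quot e I₀ m.1) where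
  carrier := {x | ∀ m (hm : i ≤ m), h.frobProj m (x ⟨m + 1, hm.trans m.le_succ⟩) = x ⟨m, hm⟩}
  mul_mem' hx hy m hm := by
    simp only [Pi.mul_apply, map_mul, hx m hm, hy m hm]
  one_mem' m hm := by simp only [Pi.one_apply, map_one]
  add_mem' hx hy m hm := by
    simp only [Pi.add_apply, map_add, hx m hm, hy m hm]
  zero_mem' m hm := by simp only [Pi.zero_apply, map_zero]
  neg_mem' hx m hm := by simp only [Pi.neg_apply, map_neg, hx m hm]

/-- The map on families `(x_m)_{m ≥ i} ↦ (y_m)_{m ≥ i+1}`, where `y_{m+1}` is the image of `x_m`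
under the map induced by the transition map. -/
def tiltFun (T : RingTower.{u}) (e : R →+* T.obj 0) (I₀ : Ideal R) (i : ℕ)
    (x : ∀ m : {m : ℕ // i ≤ m}, T.Quot e I₀ m.1) :
    ∀ m : {m : ℕ // i + 1 ≤ m}, T.Quot e I₀ m.1
  | ⟨0, hm⟩ => absurd hm (Nat.not_succ_le_zero i)
  | ⟨m + 1, hm⟩ => T.quotMap e I₀ m (x ⟨m, Nat.le_of_succ_le_succ hm⟩)

/-- The transition map of the tilt, the inverse limit of the maps
`R_{i+k} / I₀ R_{i+k} → R_{i+k+1} / I₀ R_{i+k+1}`. -/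
def IsPurelyInseparable.tiltMap (h : IsPurelyInseparable p T e I₀) (i : ℕ) :
    h.smallTilt i →+* h.smallTilt (i + 1) where
  toFun x := ⟨tiltFun T e I₀ i x.1, by
    rintro (_ | m) hm
    · exact absurd hm (Nat.not_succ_le_zero i)
    · have hm' : i ≤ m := Nat.le_of_succ_le_succ hm
      have hx := x.2 m hm'
      change h.frobProj (m + 1) (T.quotMap e I₀ (m + 1) _) = T.quotMap e I₀ m _
      rw [h.frobProj_quotMap, ← hx, h.quotMap_frobProj]⟩
  map_one' := by
    ext ⟨m, hm⟩
    rcases m with _ | m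
    · exact absurd hm (Nat.not_succ_le_zero i)
    · exact map_one (T.quotMap e I₀ m)
  map_mul' x y := by
    ext ⟨m, hm⟩
    rcases m with _ | m
    · exact absurd hm (Nat.not_succ_le_zero i)
    · exact map_mul (T.quotMap e I₀ m) _ _
  map_zero' := by
    ext ⟨m, hm⟩
    rcases m with _ | m
    · exact absurd hm (Nat.not_succ_le_zero i)
    · exact map_zero (T.quotMap e I₀ m)
  map_add' x y := by
    ext ⟨m, hm⟩
    rcases m with _ | m
    · exact absurd hm (Nat.not_succ_le_zero i)
    · exact map_add (T.quotMap e I₀ m) _ _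

/-- The tilt of a perfectoid tower. -/
def IsPerfectoid.tilt (h : IsPerfectoid p T e I₀) : RingTower.{u} where
  obj i := h.toIsPurelyInseparable.smallTilt i
  map i := h.toIsPurelyInseparable.tiltMap i

end Tilt

end RingTower

/-! ### Delta structures -/

/-- A `δ`-structure (with respect to the prime `p`) on a commutative ring. The polynomial
`((a ^ p + b ^ p) - (a + b) ^ p) / p` is written out with its integer coefficients
`-(p choose k) / p`. -/
structure DeltaStructure (p : ℕ) (A : Type*) [CommRing A] where
  /-- the map `δ` -/
  delta : A → A
  delta_zero : delta 0 = 0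
  delta_one : delta 1 = 0
  delta_add : ∀ a b, delta (a + b) = delta a + delta b -
    ∑ k ∈ Finset.Ioo 0 p, ((p.choose k / p : ℕ) : A) * a ^ k * b ^ (p - k)
  delta_mul : ∀ a b, delta (a * b) =
    a ^ p * delta b + b ^ p * delta a + (p : A) * delta a * delta b

/-! ### Completed semigroup rings -/

/-- The ring map between adic completions induced by a ring map `f` with `f(I) ⊆ J`. -/
def adicCompletionMap {A B : Type*} [CommRing A] [CommRing B] {I : Ideal A} {J : Ideal B}
    (f : A →+* B) (h : I ≤ J.comap f) : AdicCompletion I A →+* AdicCompletion J B :=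
  AdicCompletion.liftRingHom J
    (fun k => (Ideal.quotientMap (J ^ k) f
      ((Ideal.pow_right_mono h k).trans (Ideal.le_comap_pow f k))).comp
        (AdicCompletion.evalₐ I k).toRingHom)
    (by
      intro m k hle
      ext x
      obtain ⟨y, rfl⟩ := AdicCompletion.mk_surjective I A x
      have h1 := congrArg (Ideal.quotientMap (J ^ m) f
        ((Ideal.pow_right_mono h m).trans (Ideal.le_comap_pow f m)))
        (AdicCompletion.Ideal.mk_eq_mk I hle y)
      simpa using h1)

section SemigroupRing

variable {r : ℕ} {S S' : Type*} [CommRing S] [CommRing S']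
  {M M' : Type*} [AddCommMonoid M] [AddCommMonoid M']

/-- The ideal `(p, t^{g₁}, …, t^{g_r})` of the monoid algebra `S[M]`. -/
def semigroupIdeal (p : ℕ) (S : Type*) [CommRing S] (g : Fin r → M) :
    Ideal (AddMonoidAlgebra S M) :=
  Ideal.span ({(p : AddMonoidAlgebra S M)} ∪
    Set.range fun j => AddMonoidAlgebra.single (g j) (1 : S))

/-- The `(p, t^{g₁}, …, t^{g_r})`-adic completion `S[[M]]` of the monoid algebra `S[M]`. -/
abbrev CompletedSemigroupRing (p : ℕ) (S : Type*) [CommRing S] (g : Fin r → M) : Type _ :=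
  AdicCompletion (semigroupIdeal p S g) (AddMonoidAlgebra S M)

/-- The ring map `S[M] → S'[M']`, `c t^m ↦ f(c) t^{φ(m)}`. -/
def semigroupRingMap (f : S →+* S') (φ : M →+ M') :
    AddMonoidAlgebra S M →+* AddMonoidAlgebra S' M' :=
  (AddMonoidAlgebra.mapDomainRingHom S' φ).comp (AddMonoidAlgebra.mapRingHom M f)

theorem semigroupRingMap_single (f : S →+* S') (φ : M →+ M') (m : M) (c : S) :
    semigroupRingMap f φ (AddMonoidAlgebra.single m c) = AddMonoidAlgebra.single (φ m) (f c) := by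
  simp [semigroupRingMap]

theorem semigroupIdeal_le_comap (p : ℕ) (f : S →+* S') (φ : M →+ M') (g : Fin r → M)
    (g' : Fin r → M') (k : ℕ) (hk : k ≠ 0) (hg : ∀ j, φ (g j) = k • g' j) :
    semigroupIdeal p S g ≤ (semigroupIdeal p S' g').comap (semigroupRingMap f φ) := by
  refine Ideal.span_le.mpr ?_
  rintro x (hx | ⟨j, rfl⟩)
  · rw [Set.mem_singleton_iff.mp hx, SetLike.mem_coe, Ideal.mem_comap, map_natCast]
    exact Ideal.subset_span (Or.inl rfl)
  · rw [SetLike.mem_coe, Ideal.mem_comap, semigroupRingMap_single, hg, map_one, ← one_pow (M := S') k,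
      ← AddMonoidAlgebra.single_pow]
    have h1 : AddMonoidAlgebra.single (g' j) (1 : S') ∈ semigroupIdeal p S' g' :=
      Ideal.subset_span (Or.inr ⟨j, rfl⟩)
    exact Ideal.pow_mem_of_mem _ h1 k (Nat.pos_of_ne_zero hk)

/-- The ring map `S[[M]] → S'[[M']]` of completed semigroup rings with `c t^m ↦ f(c) t^{φ(m)}`,
where `φ` sends the chosen generator `g_j` of `M` to the `k`-th multiple of `g'_j`. -/
def completedSemigroupRingMap (p : ℕ) (f : S →+* S') (φ : M →+ M') (g : Fin r → M)
    (g' : Fin r → M') (k : ℕ) (hk : k ≠ 0) (hg : ∀ j, φ (g j) = k • g' j) :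
    CompletedSemigroupRing p S g →+* CompletedSemigroupRing p S' g' :=
  adicCompletionMap (semigroupRingMap f φ) (semigroupIdeal_le_comap p f φ g g' k hk hg)

end SemigroupRing

/-! ### The affine semigroup and its roots -/

section AffineSemigroup

variable {n r : ℕ}

/-- The affine semigroup `H ⊆ ℕⁿ` generated by `a₁, …, a_r`. -/
abbrev affineSemigroup (a : Fin r → Fin n →₀ ℕ) : AddSubmonoid (Fin n →₀ ℕ) :=
  AddSubmonoid.closure (Set.range a)

/-- The generators `a_j` of `H`. -/
def affineGen (a : Fin r → Fin n →₀ ℕ) (j : Fin r) : affineSemigroup a :=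
  ⟨a j, AddSubmonoid.subset_closure ⟨j, rfl⟩⟩

/-- The inclusion `ℕⁿ → (ℚ≥0)ⁿ`. -/
def castVec (n : ℕ) : (Fin n →₀ ℕ) →+ (Fin n →₀ ℚ≥0) :=
  Finsupp.mapRange.addMonoidHom (Nat.castAddMonoidHom ℚ≥0)

/-- The vector `a_j / p^i`. -/
def rootVec (p : ℕ) (a : Fin r → Fin n →₀ ℕ) (i : ℕ) (j : Fin r) : Fin n →₀ ℚ≥0 :=
  (1 / (p : ℚ≥0) ^ i) • castVec n (a j)

/-- The monoid `H^{1/p^i}` generated by the vectors `a_j / p^i`. -/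
abbrev rootSemigroup (p : ℕ) (a : Fin r → Fin n →₀ ℕ) (i : ℕ) : AddSubmonoid (Fin n →₀ ℚ≥0) :=
  AddSubmonoid.closure (Set.range (rootVec p a i))

/-- The generators `a_j / p^i` of `H^{1/p^i}`. -/
def rootGen (p : ℕ) (a : Fin r → Fin n →₀ ℕ) (i : ℕ) (j : Fin r) : rootSemigroup p a i :=
  ⟨rootVec p a i j, AddSubmonoid.subset_closure ⟨j, rfl⟩⟩

theorem rootVec_succ (p : ℕ) [Fact p.Prime] (a : Fin r → Fin n →₀ ℕ) (i : ℕ) (j : Fin r) :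
    rootVec p a i j = p • rootVec p a (i + 1) j := by
  have hp : (p : ℚ≥0) ≠ 0 := Nat.cast_ne_zero.mpr (Fact.out : p.Prime).ne_zero
  unfold rootVec
  rw [← Nat.cast_smul_eq_nsmul ℚ≥0, smul_smul]
  congr 1
  field_simp
  rw [pow_succ]

theorem rootSemigroup_le (p : ℕ) [Fact p.Prime] (a : Fin r → Fin n →₀ ℕ) (i : ℕ) :
    rootSemigroup p a i ≤ rootSemigroup p a (i + 1) := by
  refine AddSubmonoid.closure_le.mpr ?_
  rintro _ ⟨j, rfl⟩
  rw [rootVec_succ]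
  exact AddSubmonoid.nsmul_mem _ (AddSubmonoid.subset_closure (Set.mem_range_self j)) p

theorem castVec_mem (p : ℕ) (a : Fin r → Fin n →₀ ℕ) (h : affineSemigroup a) :
    ((castVec n).comp (affineSemigroup a).subtype) h ∈ rootSemigroup p a 0 := by
  have h1 : affineSemigroup a ≤ (rootSemigroup p a 0).comap (castVec n) := by
    refine AddSubmonoid.closure_le.mpr ?_
    rintro _ ⟨j, rfl⟩
    exact AddSubmonoid.subset_closure ⟨j, by simp [rootVec]⟩
  exact h1 h.2

/-- The identification `H → H^{1/p^0}`. -/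
def affineToRoot (p : ℕ) (a : Fin r → Fin n →₀ ℕ) : affineSemigroup a →+ rootSemigroup p a 0 :=
  ((castVec n).comp (affineSemigroup a).subtype).codRestrict (rootSemigroup p a 0)
    (castVec_mem p a)

theorem affineToRoot_gen (p : ℕ) (a : Fin r → Fin n →₀ ℕ) (j : Fin r) :
    affineToRoot p a (affineGen a j) = 1 • rootGen p a 0 j := by
  refine Subtype.ext ?_
  change castVec n (a j) = _
  simp [rootGen, rootVec]

/-- The embedding of the semigroup ring `S[H]` into the polynomial ring, `t^h ↦ t^h`. -/
def semigroupToPolynomial (S : Type*) [CommRing S] (a : Fin r → Fin n →₀ ℕ) :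
    AddMonoidAlgebra S (affineSemigroup a) →ₐ[S] MvPolynomial (Fin n) S :=
  AddMonoidAlgebra.mapDomainAlgHom S S (affineSemigroup a).subtype

/-- The ring map `t^h ↦ t^{ph}` on `ℤ_p[H]`. -/
def semigroupFrobenius (p : ℕ) [Fact p.Prime] (a : Fin r → Fin n →₀ ℕ) :
    AddMonoidAlgebra ℤ_[p] (affineSemigroup a) →+* AddMonoidAlgebra ℤ_[p] (affineSemigroup a) :=
  semigroupRingMap (RingHom.id _) (nsmulAddMonoidHom p)

/-- The completed semigroup ring `ℤ_p[[H]]`. -/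
abbrev ZpH (p : ℕ) [Fact p.Prime] (a : Fin r → Fin n →₀ ℕ) : Type :=
  CompletedSemigroupRing p ℤ_[p] (affineGen a)

/-- The ring map `t^h ↦ t^{ph}` on `ℤ_p[[H]]`. -/
def completedFrobenius (p : ℕ) [Fact p.Prime] (a : Fin r → Fin n →₀ ℕ) : ZpH p a →+* ZpH p a :=
  completedSemigroupRingMap p (RingHom.id _) (nsmulAddMonoidHom p) (affineGen a) (affineGen a)
    p (Fact.out : p.Prime).ne_zero (fun _ => rfl)

/-- The ring `ℤ_p[p^{1/p^i}]`, where `ϖ i` is the chosen `p^i`-th root of `p`. -/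
def rootRing (p : ℕ) [Fact p.Prime] (ϖ : ℕ → AlgebraicClosure ℚ_[p]) (i : ℕ) :
    Subalgebra ℤ_[p] (AlgebraicClosure ℚ_[p]) :=
  Algebra.adjoin ℤ_[p] {ϖ i}

theorem rootRing_le (p : ℕ) [Fact p.Prime] (ϖ : ℕ → AlgebraicClosure ℚ_[p])
    (hϖ : ∀ i, ϖ (i + 1) ^ p = ϖ i) (i : ℕ) : rootRing p ϖ i ≤ rootRing p ϖ (i + 1) := by
  refine Algebra.adjoin_le ?_
  rw [Set.singleton_subset_iff, ← hϖ i]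
  exact Subalgebra.pow_mem _ (Algebra.self_mem_adjoin_singleton ℤ_[p] (ϖ (i + 1))) p

/-- The tower `ℤ_p[[H]] → ℤ_p[p^{1/p}][[H^{1/p}]] → ⋯ → ℤ_p[p^{1/p^i}][[H^{1/p^i}]] → ⋯`, with
transition maps induced by the inclusions of coefficient rings and of monoids. -/
def semigroupTower (p : ℕ) [Fact p.Prime] (a : Fin r → Fin n →₀ ℕ)
    (ϖ : ℕ → AlgebraicClosure ℚ_[p]) (hϖ : ∀ i, ϖ (i + 1) ^ p = ϖ i) : RingTower.{0} where
  obj i := CompletedSemigroupRing p (rootRing p ϖ i) (rootGen p a i)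
  map i := completedSemigroupRingMap p
    (Subalgebra.inclusion (rootRing_le p ϖ hϖ i)).toRingHom
    (AddSubmonoid.inclusion (rootSemigroup_le p a i)) (rootGen p a i) (rootGen p a (i + 1))
    p (Fact.out : p.Prime).ne_zero (fun j => Subtype.ext (rootVec_succ p a i j))

/-- The canonical map from `ℤ_p[[H]]` to the `0`-th term of the tower, `c t^h ↦ c t^h`. -/
def semigroupTowerBase (p : ℕ) [Fact p.Prime] (a : Fin r → Fin n →₀ ℕ)
    (ϖ : ℕ → AlgebraicClosure ℚ_[p]) (hϖ : ∀ i, ϖ (i + 1) ^ p = ϖ i) :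
    ZpH p a →+* (semigroupTower p a ϖ hϖ).obj 0 :=
  completedSemigroupRingMap p (algebraMap ℤ_[p] (rootRing p ϖ 0)) (affineToRoot p a)
    (affineGen a) (rootGen p a 0) 1 one_ne_zero
    (affineToRoot_gen p a)

/-- The inclusion `𝔽_p[[H^{1/p^i}]] → 𝔽_p[[H^{1/p^{i+1}}]]`. -/
def charPMap (p : ℕ) [Fact p.Prime] (a : Fin r → Fin n →₀ ℕ) (i : ℕ) :
    CompletedSemigroupRing p (ZMod p) (rootGen p a i) →+*
      CompletedSemigroupRing p (ZMod p) (rootGen p a (i + 1)) :=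
  completedSemigroupRingMap p (RingHom.id _)
    (AddSubmonoid.inclusion (rootSemigroup_le p a i)) (rootGen p a i) (rootGen p a (i + 1))
    p (Fact.out : p.Prime).ne_zero (fun j => Subtype.ext (rootVec_succ p a i j))

/-- The tower `𝔽_p[[H]][[T]] → 𝔽_p[[H^{1/p}]][[T]] → ⋯ → 𝔽_p[[H^{1/p^i}]][[T]] → ⋯`, in which the
variable `T` of the `i`-th term stands for `T^{1/p^i}`: the transition maps are the inclusions on
the coefficient rings and send `T` to `T ^ p`. -/
def charPTower (p : ℕ) [Fact p.Prime] (a : Fin r → Fin n →₀ ℕ) : RingTower.{0} where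
  obj i := PowerSeries (CompletedSemigroupRing p (ZMod p) (rootGen p a i))
  map i := (PowerSeries.expand p (Fact.out : p.Prime).ne_zero).toRingHom.comp
    (PowerSeries.map (charPMap p a i))

end AffineSemigroup

end

noncomputable section

universe u v

/-! ### Power series supported on a submonoid -/

/-! Suppose first that every generator `a j` is nonzero. Over a `p`-adically complete ring `S`, the
completed semigroup ring is then the ring of all power series over `S` with exponents in `H`
(`SemigroupChart.exists_equiv`). The point is that the `k`-th power of the defining ideal consists
of the elements whose coefficient at `h` is divisible by `p ^ (k - ℓ(h))`, where `ℓ(h)` is the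
largest number of generators summing to `h` (`SemigroupChart.comap_wordIdeal`).

Multiplication by `p^i` identifies `H^{1/p^i}` with `H`, and turns the inclusion into
`H^{1/p^{i+1}}` into multiplication by `p`. Every transition map thus becomes `∑ c_h t^h ↦ ∑ f(c_h)
t^{ph}`, with `f` a map of coefficient rings (`SemigroupChart.equiv_completedSemigroupRingMap`).

Since `X^{p^i} - p` is Eisenstein, `ℤ_p[p^{1/p^i}]` modulo `p` is `𝔽_p[[X]]/(X^{p^i})`, and the
inclusion into the next such ring reduces to the `p`-th power map (`exists_adjoin_reduction`,
`adjoinReduction_inclusion`). Let `E` be the ring of power series over `𝔽_p[[X]]` with exponents in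
`H`, and let `τ = X`. Modulo `p` the tower consists of the rings `E/τ^{p^i}`, with transition maps
induced by the Frobenius of `E`; this is what `RingTower.FrobeniusModel` records.

The perfectoid axioms can be read off from such a model. The Frobenius projections are the canonical
projections `E/τ^{p^{i+1}} → E/τ^{p^i}`, and their kernels are generated by `τ^{p^i}`, the image of
`p^{1/p}`. As `E` is `τ`-adically complete, every term of the tilt is `E` (`toSmallTilt_bijective`),
with the Frobenius as transition map. The tower of the rings `𝔽_p[[H^{1/p^i}]][[T]]` has the same
description (`charPTowerEquiv_map`).

The `δ`-structure comes from dividing `φ(x) - x^p` by the nonzerodivisor `p`. If some generator is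
zero, then `1 = t^0` lies in the defining ideal, all completions are zero rings, and the
corresponding claims are trivial. -/

theorem isAdicComplete_span_singleton_iff {A : Type*} [CommRing A] (c : A) :
    IsAdicComplete (Ideal.span {c}) A ↔ (∀ x : A, (∀ k, c ^ k ∣ x) → x = 0) ∧
      ∀ f : ℕ → A, (∀ k, c ^ k ∣ f (k + 1) - f k) → ∃ L, ∀ k, c ^ k ∣ f k - L := by
  have key : ∀ (k : ℕ) (x y : A),
      x ≡ y [SMOD ((Ideal.span {c}) ^ k • ⊤ : Submodule A A)] ↔ c ^ k ∣ x - y := by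
    intro k x y
    rw [SModEq.sub_mem, smul_eq_mul, Ideal.mul_top, Ideal.span_singleton_pow,
      Ideal.mem_span_singleton]
  constructor
  · intro h
    refine ⟨fun x hx => h.haus' x fun k => (key k x 0).mpr (by simpa using hx k), ?_⟩
    intro f hf
    obtain ⟨L, hL⟩ := h.prec' f (by
      intro m k hmk
      rw [key]
      induction k, hmk using Nat.le_induction with
      | base => simp
      | succ k hmk ih =>
        have : f m - f (k + 1) = (f m - f k) - (f (k + 1) - f k) := by ring
        rw [this]
        exact dvd_sub ih ((pow_dvd_pow c hmk).trans (hf k)))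
    exact ⟨L, fun k => (key k _ _).mp (hL k)⟩
  · rintro ⟨h1, h2⟩
    refine { haus' := fun x hx => h1 x fun k => ?_, prec' := fun f hf => ?_ }
    · simpa using (key k x 0).mp (hx k)
    · obtain ⟨L, hL⟩ := h2 f fun k => by
        have := (key k _ _).mp (hf k.le_succ)
        rwa [dvd_sub_comm]
      exact ⟨L, fun k => (key k _ _).mpr (hL k)⟩

section SupportedPowerSeries

variable {σ : Type*} (N : AddSubmonoid (σ →₀ ℕ)) (S : Type*) [CommRing S]

/-- The power series all of whose exponents lie in the submonoid `N`. -/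
def supportedPowerSeries : Subalgebra S (MvPowerSeries σ S) where
  carrier := {f | ∀ h ∉ N, MvPowerSeries.coeff h f = 0}
  mul_mem' {f g} hf hg h hh := by
    classical
    rw [MvPowerSeries.coeff_mul]
    refine Finset.sum_eq_zero fun x hx => ?_
    by_cases h1 : x.1 ∈ N
    · by_cases h2 : x.2 ∈ N
      · exact absurd (Finset.HasAntidiagonal.mem_antidiagonal.mp hx ▸ N.add_mem h1 h2) hh
      · rw [hg _ h2, mul_zero]
    · rw [hf _ h1, zero_mul]
  add_mem' {f g} hf hg h hh := by rw [map_add, hf h hh, hg h hh, add_zero]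
  algebraMap_mem' c h hh := by
    classical
    rw [MvPowerSeries.algebraMap_apply, MvPowerSeries.coeff_C, if_neg]
    rintro rfl
    exact hh N.zero_mem

namespace supportedPowerSeries

variable {N S} {S' : Type*} [CommRing S']

/-- The coefficients of a supported power series. -/
def coeff (h : σ →₀ ℕ) : supportedPowerSeries N S →ₗ[S] S :=
  (MvPowerSeries.coeff h).comp (supportedPowerSeries N S).val.toLinearMap

theorem coeff_def (h : σ →₀ ℕ) (f : supportedPowerSeries N S) :
    coeff h f = MvPowerSeries.coeff h f.1 := rfl

theorem coeff_of_notMem {h : σ →₀ ℕ} (hh : h ∉ N) (f : supportedPowerSeries N S) :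
    coeff h f = 0 := f.2 h hh

@[ext]
theorem ext {f g : supportedPowerSeries N S} (H : ∀ h ∈ N, coeff h f = coeff h g) : f = g := by
  refine Subtype.ext (MvPowerSeries.ext fun h => ?_)
  by_cases hh : h ∈ N
  · exact H h hh
  · rw [f.2 h hh, g.2 h hh]

theorem coeff_mul [DecidableEq σ] (h : σ →₀ ℕ) (f g : supportedPowerSeries N S) :
    coeff h (f * g) = ∑ x ∈ Finset.HasAntidiagonal.antidiagonal h, coeff x.1 f * coeff x.2 g :=
  MvPowerSeries.coeff_mul _ _ _

theorem coeff_algebraMap_mul (h : σ →₀ ℕ) (c : S) (f : supportedPowerSeries N S) :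
    coeff h (algebraMap S _ c * f) = c * coeff h f := by
  rw [← Algebra.smul_def, map_smul, smul_eq_mul]

/-- The supported power series with given coefficients at the elements of `N`. -/
def ofFun (F : (σ →₀ ℕ) → S) : supportedPowerSeries N S :=
  ⟨fun h => by classical exact if h ∈ N then F h else 0, fun h hh => by
    classical
    exact if_neg hh⟩

theorem coeff_ofFun {h : σ →₀ ℕ} (hh : h ∈ N) (F : (σ →₀ ℕ) → S) :
    coeff h (ofFun F : supportedPowerSeries N S) = F h := by
  classical
  exact if_pos hh

/-- Supports may be infinite, so quotients can be chosen one coefficient at a time. Completeness,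
kernels and divisibility by constants thereby reduce to statements about `S`. -/
theorem algebraMap_dvd_iff (c : S) (f : supportedPowerSeries N S) :
    algebraMap S _ c ∣ f ↔ ∀ h, c ∣ coeff h f := by
  constructor
  · rintro ⟨g, rfl⟩ h
    rw [coeff_algebraMap_mul]
    exact dvd_mul_right _ _
  · intro H
    choose F hF using H
    refine ⟨ofFun F, ext fun h hh => ?_⟩
    rw [coeff_algebraMap_mul, coeff_ofFun hh, hF]

theorem isAdicComplete (c : S) (hc : IsAdicComplete (Ideal.span {c}) S) :
    IsAdicComplete (Ideal.span {algebraMap S (supportedPowerSeries N S) c})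
      (supportedPowerSeries N S) := by
  rw [isAdicComplete_span_singleton_iff] at hc ⊢
  simp only [← map_pow, algebraMap_dvd_iff, map_sub]
  refine ⟨fun f hf => ext fun h _ => ?_, fun f hf => ?_⟩
  · rw [map_zero]
    exact hc.1 _ fun k => hf k h
  · choose L hL using fun h => hc.2 (fun k => coeff h (f k)) fun k => hf k h
    refine ⟨ofFun L, fun k h => ?_⟩
    by_cases hh : h ∈ N
    · rw [coeff_ofFun hh]
      exact hL h k
    · rw [coeff_of_notMem hh, coeff_of_notMem hh, sub_zero]
      exact dvd_zero _

theorem expand_map_mem (k : ℕ) (hk : k ≠ 0) (f : S →+* S') (x : supportedPowerSeries N S) :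
    MvPowerSeries.expand k hk (MvPowerSeries.map f x.1) ∈ supportedPowerSeries N S' := by
  intro h hh
  by_contra hne
  obtain ⟨m, hm, rfl⟩ := MvPowerSeries.support_expand_subset k hk (MvPowerSeries.map f x.1) hne
  refine hh (N.nsmul_mem ?_ k)
  by_contra hm'
  refine hm ?_
  change MvPowerSeries.coeff m (MvPowerSeries.map f x.1) = 0
  rw [MvPowerSeries.coeff_map, x.2 m hm', map_zero]

/-- The ring map `∑ c_h t^h ↦ ∑ f(c_h) t^{kh}`. -/
def expandMap (k : ℕ) (hk : k ≠ 0) (f : S →+* S') :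
    supportedPowerSeries N S →+* supportedPowerSeries N S' where
  toFun x := ⟨MvPowerSeries.expand k hk (MvPowerSeries.map f x.1), expand_map_mem k hk f x⟩
  map_one' := Subtype.ext (by simp)
  map_mul' x y := Subtype.ext (by simp)
  map_zero' := Subtype.ext (by simp)
  map_add' x y := Subtype.ext (by simp)

theorem coe_expandMap (k : ℕ) (hk : k ≠ 0) (f : S →+* S') (x : supportedPowerSeries N S) :
    (expandMap k hk f x).1 = MvPowerSeries.expand k hk (MvPowerSeries.map f x.1) := rfl

theorem coeff_expandMap_smul (k : ℕ) (hk : k ≠ 0) (f : S →+* S') (x : supportedPowerSeries N S)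
    (h : σ →₀ ℕ) : coeff (k • h) (expandMap k hk f x) = f (coeff h x) := by
  rw [coeff_def, coe_expandMap, MvPowerSeries.coeff_expand_smul, MvPowerSeries.coeff_map]
  rfl

theorem coeff_expandMap_of_ne (k : ℕ) (hk : k ≠ 0) (f : S →+* S') (x : supportedPowerSeries N S)
    (h : σ →₀ ℕ) (hh : ∀ m, h ≠ k • m) : coeff h (expandMap k hk f x) = 0 := by
  by_contra hne
  obtain ⟨m, -, rfl⟩ := MvPowerSeries.support_expand_subset k hk (MvPowerSeries.map f x.1) hne
  exact hh m rfl

theorem expandMap_injective (k : ℕ) (hk : k ≠ 0) {f : S →+* S'} (hf : Function.Injective f) :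
    Function.Injective (expandMap k hk f : supportedPowerSeries N S →+* _) := by
  intro x y hxy
  refine ext fun h _ => hf ?_
  rw [← coeff_expandMap_smul k hk, hxy, coeff_expandMap_smul]

theorem expandMap_expandMap {S'' : Type*} [CommRing S''] (k : ℕ) (hk : k ≠ 0) (f : S →+* S')
    (g : S' →+* S'') (x : supportedPowerSeries N S) :
    expandMap k hk (g.comp f) x = expandMap 1 one_ne_zero g (expandMap k hk f x) := by
  refine Subtype.ext ?_
  simp only [coe_expandMap, MvPowerSeries.map_expand, MvPowerSeries.expand_one_apply]
  rfl

theorem expandMap_expandMap' {S'' : Type*} [CommRing S''] (k : ℕ) (hk : k ≠ 0) (f : S →+* S')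
    (g : S' →+* S'') (x : supportedPowerSeries N S) :
    expandMap k hk (g.comp f) x = expandMap k hk g (expandMap 1 one_ne_zero f x) := by
  refine Subtype.ext ?_
  simp only [coe_expandMap, MvPowerSeries.expand_one_apply]
  rfl

/-- The ring map `∑ c_h t^h ↦ ∑ f(c_h) t^h`. -/
abbrev map (f : S →+* S') : supportedPowerSeries N S →+* supportedPowerSeries N S' :=
  expandMap 1 one_ne_zero f

theorem coeff_map (f : S →+* S') (x : supportedPowerSeries N S) (h : σ →₀ ℕ) :
    coeff h (map f x) = f (coeff h x) := by
  simpa using coeff_expandMap_smul 1 one_ne_zero f x h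

theorem map_surjective {f : S →+* S'} (hf : Function.Surjective f) :
    Function.Surjective (map f : supportedPowerSeries N S →+* _) := by
  intro y
  choose g hg using hf
  refine ⟨ofFun fun h => g (coeff h y), ext fun h hh => ?_⟩
  rw [coeff_map, coeff_ofFun hh, hg]

theorem ker_map {f : S →+* S'} {c : S} (hf : RingHom.ker f = Ideal.span {c}) :
    RingHom.ker (map f : supportedPowerSeries N S →+* _) = Ideal.span {algebraMap S _ c} := by
  ext x
  rw [Ideal.mem_span_singleton, algebraMap_dvd_iff, RingHom.mem_ker]
  have : ∀ s, f s = 0 ↔ c ∣ s := fun s => by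
    rw [← RingHom.mem_ker, hf, Ideal.mem_span_singleton]
  constructor
  · intro hx h
    rw [← this, ← coeff_map, hx, map_zero]
  · intro hx
    refine ext fun h _ => ?_
    rw [coeff_map, (this _).mpr (hx h), map_zero]

/-- In characteristic `p`, the Frobenius map is `∑ c_h t^h ↦ ∑ c_h^p t^{ph}`. -/
theorem expandMap_frobenius (p : ℕ) [Fact p.Prime] [CharP S p] (x : supportedPowerSeries N S) :
    expandMap p (Fact.out : p.Prime).ne_zero (frobenius S p) x = x ^ p := by
  refine Subtype.ext ?_
  rw [coe_expandMap, ← MvPowerSeries.map_expand]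
  exact MvPowerSeries.map_frobenius_expand p (Fact.out : p.Prime).ne_zero

theorem expandMap_id_zmod (p : ℕ) [Fact p.Prime] (x : supportedPowerSeries N (ZMod p)) :
    expandMap p (Fact.out : p.Prime).ne_zero (RingHom.id _) x = x ^ p := by
  rw [← ZMod.frobenius_zmod p, expandMap_frobenius]

end supportedPowerSeries

end SupportedPowerSeries

/-! ### Recognizing adic completions -/

/-- Density and the pullback condition give `B / I^k ≅ C / K k`, and `C` is the limit of its
quotients `C / K k`. The `K k` need not be powers of an ideal of `C`. The approximation property in
the conclusion is what later identifies maps between completions. -/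
theorem AdicCompletion.exists_ringEquiv {B C : Type*} [CommRing B] [CommRing C] (I : Ideal B)
    (j : B →+* C) (K : ℕ → Ideal C) (hK : Antitone K) (hcomap : ∀ k, (K k).comap j = I ^ k)
    (hdense : ∀ k c, ∃ b, c - j b ∈ K k) (hhaus : ∀ c, (∀ k, c ∈ K k) → c = 0)
    (hcompl : ∀ f : ℕ → C, (∀ k, f (k + 1) - f k ∈ K k) → ∃ L, ∀ k, f k - L ∈ K k) :
    ∃ e : AdicCompletion I B ≃+* C,
      ∀ x k b, AdicCompletion.evalₐ I k x = Ideal.Quotient.mk _ b → e x - j b ∈ K k := by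
  have hbij : ∀ k, Function.Bijective (Ideal.quotientMap (K k) j (hcomap k).ge) := by
    intro k
    refine ⟨Ideal.quotientMap_injective' (hcomap k).le, fun y => ?_⟩
    obtain ⟨c, rfl⟩ := Ideal.Quotient.mk_surjective y
    obtain ⟨b, hb⟩ := hdense k c
    exact ⟨Ideal.Quotient.mk _ b, by
      rw [Ideal.quotientMap_mk]; exact (Ideal.Quotient.eq.mpr hb).symm⟩
  let g : ∀ k, C →+* B ⧸ I ^ k := fun k =>
    (RingEquiv.ofBijective _ (hbij k)).symm.toRingHom.comp (Ideal.Quotient.mk (K k))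
  have hg : ∀ k c b, g k c = Ideal.Quotient.mk _ b ↔ c - j b ∈ K k := by
    intro k c b
    change (RingEquiv.ofBijective _ (hbij k)).symm (Ideal.Quotient.mk (K k) c) = _ ↔ _
    rw [RingEquiv.symm_apply_eq, RingEquiv.ofBijective_apply, Ideal.quotientMap_mk,
      Ideal.Quotient.eq]
  let F : C →+* AdicCompletion I B := AdicCompletion.liftRingHom I g (by
    intro m n hle
    ext c
    obtain ⟨b, hb⟩ := hdense n c
    have h1 := (hg n c b).mpr hb
    have h2 := (hg m c b).mpr (hK hle hb)
    rw [RingHom.comp_apply, h1, h2]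
    rfl)
  have hF : ∀ k c, AdicCompletion.evalₐ I k (F c) = g k c :=
    fun k c => AdicCompletion.evalₐ_liftRingHom I g _ k c
  have hFbij : Function.Bijective F := by
    constructor
    · intro c c' hcc
      rw [← sub_eq_zero]
      refine hhaus _ fun k => ?_
      obtain ⟨b, hb⟩ := hdense k c'
      have h1 : g k c = Ideal.Quotient.mk _ b := by rw [← hF, hcc, hF, (hg k c' b).mpr hb]
      simpa using sub_mem ((hg k c b).mp h1) hb
    · intro x
      obtain ⟨y, rfl⟩ := AdicCompletion.mk_surjective I B x
      obtain ⟨L, hL⟩ := hcompl (fun k => j (y k)) fun k => by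
        rw [← map_sub, ← Ideal.mem_comap, hcomap, ← Ideal.Quotient.eq]
        exact AdicCompletion.Ideal.mk_eq_mk I k.le_succ y
      refine ⟨L, AdicCompletion.ext_evalₐ fun k => ?_⟩
      rw [hF, AdicCompletion.evalₐ_mk, hg, ← neg_sub]
      exact neg_mem (hL k)
  refine ⟨(RingEquiv.ofBijective F hFbij).symm, fun x k b hx => ?_⟩
  obtain ⟨c, rfl⟩ := hFbij.2 x
  rw [hF, hg] at hx
  rwa [← RingEquiv.ofBijective_apply F hFbij, RingEquiv.symm_apply_apply]

/-! ### Word length in an affine semigroup -/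

section WordLength

variable {n r : ℕ}

/-- The maximal number of generators `a_j` that sum up to `h`. -/
def wordLength (a : Fin r → Fin n →₀ ℕ) (h : Fin n →₀ ℕ) : ℕ :=
  sSup {c | ∃ s : Multiset (Fin r), s.card = c ∧ (s.map a).sum = h}

variable {a : Fin r → Fin n →₀ ℕ}

/-- A nonzero generator has degree at least one, so a word for `h` has at most `h.degree` letters.
Hence the supremum defining `wordLength` is a genuine maximum when `h` lies in the semigroup. -/
theorem bddAbove_wordLength (ha : ∀ j, a j ≠ 0) (h : Fin n →₀ ℕ) :
    BddAbove {c | ∃ s : Multiset (Fin r), s.card = c ∧ (s.map a).sum = h} := by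
  refine ⟨h.degree, ?_⟩
  rintro _ ⟨s, rfl, rfl⟩
  induction s using Multiset.induction with
  | empty => simp
  | cons j s ih =>
    have : 1 ≤ (a j).degree := Nat.one_le_iff_ne_zero.mpr fun h0 =>
      ha j ((Finsupp.degree_eq_zero_iff _).mp h0)
    simp only [Multiset.card_cons, Multiset.map_cons, Multiset.sum_cons, map_add]
    omega

theorem le_wordLength (ha : ∀ j, a j ≠ 0) (s : Multiset (Fin r)) :
    s.card ≤ wordLength a (s.map a).sum :=
  le_csSup (bddAbove_wordLength ha _) ⟨s, rfl, rfl⟩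

theorem exists_multiset_sum_eq {h : Fin n →₀ ℕ} (hh : h ∈ affineSemigroup a) :
    ∃ s : Multiset (Fin r), (s.map a).sum = h := by
  induction hh using AddSubmonoid.closure_induction with
  | mem x hx =>
    obtain ⟨j, rfl⟩ := hx
    exact ⟨{j}, by simp⟩
  | zero => exact ⟨0, by simp⟩
  | add x y _ _ hx hy =>
    obtain ⟨s, rfl⟩ := hx
    obtain ⟨t, rfl⟩ := hy
    exact ⟨s + t, by simp⟩

theorem exists_card_eq_wordLength (ha : ∀ j, a j ≠ 0) {h : Fin n →₀ ℕ}
    (hh : h ∈ affineSemigroup a) :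
    ∃ s : Multiset (Fin r), s.card = wordLength a h ∧ (s.map a).sum = h := by
  obtain ⟨s, hs⟩ := exists_multiset_sum_eq hh
  exact Nat.sSup_mem (s := {c | ∃ s : Multiset (Fin r), s.card = c ∧ (s.map a).sum = h})
    ⟨s.card, s, rfl, hs⟩ (bddAbove_wordLength ha h)

theorem wordLength_add (ha : ∀ j, a j ≠ 0) {h h' : Fin n →₀ ℕ} (hh : h ∈ affineSemigroup a)
    (hh' : h' ∈ affineSemigroup a) :
    wordLength a h + wordLength a h' ≤ wordLength a (h + h') := by
  obtain ⟨s, hs, rfl⟩ := exists_card_eq_wordLength ha hh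
  obtain ⟨t, ht, rfl⟩ := exists_card_eq_wordLength ha hh'
  rw [← hs, ← ht, ← Multiset.card_add, ← Multiset.sum_add, ← Multiset.map_add]
  exact le_wordLength ha _

theorem wordLength_le_nsmul (ha : ∀ j, a j ≠ 0) {h : Fin n →₀ ℕ} (hh : h ∈ affineSemigroup a)
    {k : ℕ} (hk : k ≠ 0) : wordLength a h ≤ wordLength a (k • h) := by
  obtain ⟨k, rfl⟩ := Nat.exists_eq_succ_of_ne_zero hk
  rw [succ_nsmul']
  exact (Nat.le_add_right _ _).trans
    (wordLength_add ha hh (AddSubmonoid.nsmul_mem _ hh k))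

theorem one_le_wordLength (ha : ∀ j, a j ≠ 0) (j : Fin r) : 1 ≤ wordLength a (a j) := by
  simpa using le_wordLength ha {j}

/-- Each letter of a word contributes at most `∑ j, (a j).degree`, so bounded word length forces
bounded degree. -/
theorem finite_wordLength_lt (ha : ∀ j, a j ≠ 0) (k : ℕ) :
    {h | h ∈ affineSemigroup a ∧ wordLength a h < k}.Finite := by
  refine (Finsupp.finite_of_degree_le ((∑ j, (a j).degree) * k)).subset ?_
  rintro h ⟨hh, hk⟩
  obtain ⟨s, rfl⟩ := exists_multiset_sum_eq hh
  have hs := (le_wordLength ha s).trans hk.le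
  have : ((s.map a).sum).degree ≤ (∑ j, (a j).degree) * s.card := by
    clear hh hk hs
    induction s using Multiset.induction with
    | empty => simp
    | cons j s ih =>
      have : (a j).degree ≤ ∑ j, (a j).degree :=
        Finset.single_le_sum (f := fun j => (a j).degree) (fun _ _ => Nat.zero_le _)
          (Finset.mem_univ j)
      simp only [Multiset.card_cons, Multiset.map_cons, Multiset.sum_cons, map_add]
      rw [mul_add]
      omega
  exact this.trans (Nat.mul_le_mul_left _ hs)

end WordLength

/-! ### Completed semigroup rings as rings of power series -/

section WordIdeal

variable {n r : ℕ} {a : Fin r → Fin n →₀ ℕ} {S : Type*} [CommRing S]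

open supportedPowerSeries

/-- Word length is superadditive, so `(k - ℓ(x)) + (l - ℓ(y)) ≥ k + l - ℓ(x + y)`, also with
truncated subtraction. -/
theorem pow_dvd_coeff_mul (ha : ∀ j, a j ≠ 0) (c : S) {k l : ℕ}
    {f g : supportedPowerSeries (affineSemigroup a) S}
    (hf : ∀ h, c ^ (k - wordLength a h) ∣ coeff h f)
    (hg : ∀ h, c ^ (l - wordLength a h) ∣ coeff h g) (h : Fin n →₀ ℕ) :
    c ^ (k + l - wordLength a h) ∣ coeff h (f * g) := by
  classical
  rw [supportedPowerSeries.coeff_mul]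
  refine Finset.dvd_sum fun x hx => ?_
  by_cases h1 : x.1 ∈ affineSemigroup a
  · by_cases h2 : x.2 ∈ affineSemigroup a
    · have hl := wordLength_add ha h1 h2
      rw [Finset.HasAntidiagonal.mem_antidiagonal.mp hx] at hl
      refine (pow_dvd_pow c ?_).trans (pow_add c _ _ ▸ mul_dvd_mul (hf x.1) (hg x.2))
      omega
    · rw [coeff_of_notMem h2, mul_zero]
      exact dvd_zero _
  · rw [coeff_of_notMem h1, zero_mul]
    exact dvd_zero _

/-- The ideal of the power series whose coefficient at `h` is divisible by
`c ^ (k - wordLength h)`. -/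
def wordIdeal (ha : ∀ j, a j ≠ 0) (c : S) (k : ℕ) :
    Ideal (supportedPowerSeries (affineSemigroup a) S) where
  carrier := {f | ∀ h, c ^ (k - wordLength a h) ∣ coeff h f}
  add_mem' hf hg h := by
    rw [map_add]
    exact dvd_add (hf h) (hg h)
  zero_mem' h := by
    rw [map_zero]
    exact dvd_zero _
  smul_mem' x f hf h := by
    -- With `k = 0` the condition on the multiplier `x` is vacuous.
    have := pow_dvd_coeff_mul ha c (k := 0) (f := x) (by simp) hf h
    rwa [zero_add] at this

theorem wordIdeal_antitone (ha : ∀ j, a j ≠ 0) (c : S) : Antitone (wordIdeal ha c) :=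
  fun _ _ hkl _ hf h => (pow_dvd_pow c (by omega)).trans (hf h)

theorem eq_zero_of_mem_wordIdeal (ha : ∀ j, a j ≠ 0) {c : S}
    (hc : IsAdicComplete (Ideal.span {c}) S) (f : supportedPowerSeries (affineSemigroup a) S)
    (hf : ∀ k, f ∈ wordIdeal ha c k) : f = 0 := by
  rw [isAdicComplete_span_singleton_iff] at hc
  refine supportedPowerSeries.ext fun h _ => ?_
  rw [map_zero]
  refine hc.1 _ fun k => ?_
  simpa using hf (k + wordLength a h) h

theorem exists_limit_wordIdeal (ha : ∀ j, a j ≠ 0) {c : S}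
    (hc : IsAdicComplete (Ideal.span {c}) S)
    (f : ℕ → supportedPowerSeries (affineSemigroup a) S)
    (hf : ∀ k, f (k + 1) - f k ∈ wordIdeal ha c k) : ∃ L, ∀ k, f k - L ∈ wordIdeal ha c k := by
  rw [isAdicComplete_span_singleton_iff] at hc
  -- At `h` the hypothesis controls consecutive differences only modulo `c ^ (k - wordLength a h)`;
  -- shifting the index by `wordLength a h` gives a `c`-adic Cauchy sequence in `S`.
  choose L hL using fun h => hc.2 (fun k => coeff h (f (k + wordLength a h))) fun k => by
    have := hf (k + wordLength a h) h
    rw [map_sub, Nat.add_sub_cancel] at this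
    rwa [Nat.add_right_comm]
  refine ⟨ofFun L, fun k h => ?_⟩
  by_cases hh : h ∈ affineSemigroup a
  · rw [map_sub, coeff_ofFun hh]
    rcases le_total (wordLength a h) k with hk | hk
    · have := hL h (k - wordLength a h)
      rwa [Nat.sub_add_cancel hk] at this
    · rw [Nat.sub_eq_zero_of_le hk, pow_zero]
      exact one_dvd _
  · rw [coeff_of_notMem hh]
    exact dvd_zero _

/-- Passing from `m` to `k • m` does not shorten the longest word, so the divisibility required of
the coefficient only weakens. This is the continuity of `expandMap`. -/
theorem expandMap_mem_wordIdeal (ha : ∀ j, a j ≠ 0) {S' : Type*} [CommRing S'] {k : ℕ}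
    (hk : k ≠ 0) (f : S →+* S') (c : S) {l : ℕ}
    {x : supportedPowerSeries (affineSemigroup a) S} (hx : x ∈ wordIdeal ha c l) :
    expandMap k hk f x ∈ wordIdeal ha (f c) l := by
  intro h
  by_cases hh : ∃ m, h = k • m
  · obtain ⟨m, rfl⟩ := hh
    rw [coeff_expandMap_smul]
    by_cases hm : m ∈ affineSemigroup a
    · have := wordLength_le_nsmul ha hm hk
      refine (pow_dvd_pow _ (show _ ≤ l - wordLength a m by omega)).trans ?_
      rw [← map_pow]
      exact map_dvd f (hx m)
    · rw [coeff_of_notMem hm, map_zero]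
      exact dvd_zero _
  · rw [coeff_expandMap_of_ne k hk f x h (by simpa using hh)]
    exact dvd_zero _

end WordIdeal

theorem evalₐ_adicCompletionMap {A B : Type*} [CommRing A] [CommRing B] {I : Ideal A}
    {J : Ideal B} (f : A →+* B) (h : I ≤ J.comap f) {k : ℕ} {x : AdicCompletion I A} {b : A}
    (hb : AdicCompletion.evalₐ I k x = Ideal.Quotient.mk _ b) :
    AdicCompletion.evalₐ J k (adicCompletionMap f h x) = Ideal.Quotient.mk _ (f b) := by
  obtain ⟨y, rfl⟩ := AdicCompletion.mk_surjective I A x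
  rw [AdicCompletion.evalₐ_mk] at hb
  rw [adicCompletionMap, AdicCompletion.evalₐ_liftRingHom]
  · have h1 := congrArg (Ideal.quotientMap (J ^ k) f
      ((Ideal.pow_right_mono h k).trans (Ideal.le_comap_pow f k))) hb
    simpa using h1
  · intro m k hle
    ext x
    obtain ⟨y, rfl⟩ := AdicCompletion.mk_surjective I A x
    have h1 := congrArg (Ideal.quotientMap (J ^ m) f
      ((Ideal.pow_right_mono h m).trans (Ideal.le_comap_pow f m)))
      (AdicCompletion.Ideal.mk_eq_mk I hle y)
    simpa using h1

/-- An embedding of the monoid `M` with generators `g_j` into `ℕⁿ` such that the `g_j` go to the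
vectors `a_j`. -/
structure SemigroupChart {n r : ℕ} {M : Type*} [AddCommMonoid M] (a : Fin r → Fin n →₀ ℕ)
    (g : Fin r → M) where
  /-- the embedding -/
  toHom : M →+ (Fin n →₀ ℕ)
  injective : Function.Injective toHom
  map_gen : ∀ j, toHom (g j) = a j
  closure_eq_top : AddSubmonoid.closure (Set.range g) = ⊤

namespace SemigroupChart

open supportedPowerSeries

variable {n r : ℕ} {M M' : Type*} [AddCommMonoid M] [AddCommMonoid M'] {a : Fin r → Fin n →₀ ℕ}
  {g : Fin r → M} {g' : Fin r → M'} (φ : SemigroupChart a g) (φ' : SemigroupChart a g')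

theorem mem_affineSemigroup {h : Fin n →₀ ℕ} :
    h ∈ affineSemigroup a ↔ ∃ m, φ.toHom m = h := by
  have : affineSemigroup a = AddMonoidHom.mrange φ.toHom := by
    rw [AddMonoidHom.mrange_eq_map, ← φ.closure_eq_top, AddMonoidHom.map_mclosure,
      ← Set.range_comp]
    congr 2
    exact funext fun j => (φ.map_gen j).symm
  rw [this, AddMonoidHom.mem_mrange]

theorem toHom_mem (m : M) : φ.toHom m ∈ affineSemigroup a := φ.mem_affineSemigroup.mpr ⟨m, rfl⟩

theorem toHom_sum (s : Multiset (Fin r)) : φ.toHom (s.map g).sum = (s.map a).sum := by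
  rw [map_multiset_sum, Multiset.map_map]
  congr 1
  exact Multiset.map_congr rfl fun j _ => φ.map_gen j

/-- Seen through the charts, `ψ` is multiplication by `k`, as can be checked on generators. For the
inclusion of `H^{1/p^i}` into `H^{1/p^{i+1}}` this gives `k = p`. -/
theorem toHom_map (ψ : M →+ M') (k : ℕ) (hg : ∀ j, ψ (g j) = k • g' j) (m : M) :
    φ'.toHom (ψ m) = k • φ.toHom m := by
  have hm : m ∈ AddSubmonoid.closure (Set.range g) := φ.closure_eq_top ▸ AddSubmonoid.mem_top m
  induction hm using AddSubmonoid.closure_induction with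
  | mem x hx =>
    obtain ⟨j, rfl⟩ := hx
    rw [hg, map_nsmul, φ'.map_gen, φ.map_gen]
  | zero => simp
  | add x y _ _ hx hy => simp only [map_add, hx, hy, smul_add]

variable (S : Type*) [CommRing S]

theorem toMvPowerSeries_mem (x : AddMonoidAlgebra S M) :
    (MvPolynomial.coeToMvPowerSeries.ringHom.comp
      (AddMonoidAlgebra.mapDomainRingHom S φ.toHom)) x ∈
        supportedPowerSeries (affineSemigroup a) S := by
  intro h hh
  change (AddMonoidAlgebra.mapDomain φ.toHom x).coeff h = 0
  refine Finsupp.mapDomain_of_notMem_range _ _ ?_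
  rintro ⟨m, rfl⟩
  exact hh (φ.toHom_mem m)

/-- The embedding of the semigroup ring into the ring of power series. -/
def toSeries : AddMonoidAlgebra S M →+* supportedPowerSeries (affineSemigroup a) S :=
  RingHom.codRestrict _ _ (φ.toMvPowerSeries_mem S)

variable {S} {S' : Type*} [CommRing S']

theorem coeff_toSeries (x : AddMonoidAlgebra S M) (m : M) :
    supportedPowerSeries.coeff (φ.toHom m) (φ.toSeries S x) = x.coeff m :=
  Finsupp.mapDomain_apply φ.injective _ _

theorem single_sum_mem (p : ℕ) (s : Multiset (Fin r)) :
    AddMonoidAlgebra.single (s.map g).sum (1 : S) ∈ semigroupIdeal p S g ^ s.card := by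
  induction s using Multiset.induction with
  | empty => simp
  | cons j s ih =>
    rw [Multiset.map_cons, Multiset.sum_cons, Multiset.card_cons, pow_succ', ← one_mul (1 : S),
      ← AddMonoidAlgebra.single_mul_single]
    exact Ideal.mul_mem_mul (Ideal.subset_span (Or.inr ⟨j, rfl⟩)) ih

/-- A term `d p^{k-ℓ} t^h`, with `h` a sum of `ℓ` generators, is a multiple of a product of at least
`k` generators of the ideal. Conversely these generators lie in the first word ideal, and
`pow_dvd_coeff_mul` propagates this to powers. -/
theorem comap_wordIdeal (ha : ∀ j, a j ≠ 0) (p k : ℕ) :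
    (wordIdeal ha (p : S) k).comap (φ.toSeries S) = semigroupIdeal p S g ^ k := by
  apply le_antisymm
  · intro x hx
    rw [← AddMonoidAlgebra.sum_coeff_single x]
    refine Ideal.sum_mem _ fun m _ => ?_
    -- A word of maximal length is needed, since the coefficient is known to be divisible only by `p
    -- ^ (k - wordLength)`.
    obtain ⟨s, hs, hsum⟩ := exists_card_eq_wordLength ha (φ.toHom_mem m)
    rw [← φ.toHom_sum] at hsum
    obtain rfl := φ.injective hsum
    obtain ⟨d, hd⟩ := hx (φ.toHom (s.map g).sum)
    rw [coeff_toSeries, ← hs] at hd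
    have : AddMonoidAlgebra.single (s.map g).sum (x.coeff (s.map g).sum) =
        AddMonoidAlgebra.single 0 d * ((p : AddMonoidAlgebra S M) ^ (k - s.card) *
          AddMonoidAlgebra.single (s.map g).sum (1 : S)) := by
      rw [hd, AddMonoidAlgebra.natCast_def, AddMonoidAlgebra.single_pow,
        AddMonoidAlgebra.single_mul_single, AddMonoidAlgebra.single_mul_single]
      simp [mul_comm]
    rw [this]
    refine Ideal.mul_mem_left _ _ (Ideal.pow_le_pow_right
      (show k ≤ k - s.card + s.card by omega) ?_)
    rw [pow_add]
    refine Ideal.mul_mem_mul (Ideal.pow_mem_pow ?_ _) (single_sum_mem p s)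
    exact Ideal.subset_span (Or.inl rfl)
  · have h1 : semigroupIdeal p S g ≤ (wordIdeal ha (p : S) 1).comap (φ.toSeries S) := by
      refine Ideal.span_le.mpr ?_
      rintro x (hx | ⟨j, rfl⟩) h
      · rw [Set.mem_singleton_iff.mp hx, map_natCast,
          ← map_natCast (algebraMap S (supportedPowerSeries (affineSemigroup a) S)),
          ← mul_one (algebraMap _ _ _), coeff_algebraMap_mul]
        exact ((pow_dvd_pow _ (Nat.sub_le _ _)).trans (pow_one _).dvd).trans (dvd_mul_right _ _)
      · by_cases hh : h = a j
        · rw [hh, Nat.sub_eq_zero_of_le (one_le_wordLength ha j), pow_zero]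
          exact one_dvd _
        · have : supportedPowerSeries.coeff h
              (φ.toSeries S (AddMonoidAlgebra.single (g j) 1)) = 0 := by
            change (AddMonoidAlgebra.mapDomain φ.toHom
              (AddMonoidAlgebra.single (g j) 1)).coeff h = 0
            rw [AddMonoidAlgebra.mapDomain_single, φ.map_gen, AddMonoidAlgebra.coeff_single,
              Finsupp.single_apply, if_neg (Ne.symm hh)]
          rw [this]
          exact dvd_zero _
    induction k with
    | zero =>
      intro x _ h
      rw [Nat.zero_sub, pow_zero]
      exact one_dvd _
    | succ k ih =>
      rw [pow_succ, Ideal.mul_le]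
      intro x hx y hy h
      rw [map_mul]
      exact pow_dvd_coeff_mul ha _ (ih hx) (h1 hy) h

/-- Truncate `f` to the exponents of word length less than `k`. There are finitely many of them, and
at all others membership in the word ideal imposes no condition. -/
theorem exists_sub_mem_wordIdeal (ha : ∀ j, a j ≠ 0) (c : S) (k : ℕ)
    (f : supportedPowerSeries (affineSemigroup a) S) :
    ∃ b, f - φ.toSeries S b ∈ wordIdeal ha c k := by
  classical
  have hfin : {m | wordLength a (φ.toHom m) < k}.Finite :=
    ((finite_wordLength_lt ha k).preimage φ.injective.injOn).subset
      fun m hm => ⟨φ.toHom_mem m, hm⟩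
  refine ⟨.ofCoeff (Finsupp.indicator hfin.toFinset
    fun m _ => supportedPowerSeries.coeff (φ.toHom m) f), fun h => ?_⟩
  by_cases hh : h ∈ affineSemigroup a
  · obtain ⟨m, rfl⟩ := φ.mem_affineSemigroup.mp hh
    rw [map_sub, coeff_toSeries, AddMonoidAlgebra.coeff_ofCoeff, Finsupp.indicator_apply]
    split_ifs with hm
    · rw [sub_self]
      exact dvd_zero _
    · have : k ≤ wordLength a (φ.toHom m) := by simpa using hm
      rw [Nat.sub_eq_zero_of_le this, pow_zero]
      exact one_dvd _
  · rw [coeff_of_notMem hh]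
    exact dvd_zero _

theorem exists_equiv (ha : ∀ j, a j ≠ 0) (p : ℕ) (hS : IsAdicComplete (Ideal.span {(p : S)}) S) :
    ∃ e : CompletedSemigroupRing p S g ≃+* supportedPowerSeries (affineSemigroup a) S,
      ∀ x k b, AdicCompletion.evalₐ (semigroupIdeal p S g) k x = Ideal.Quotient.mk _ b →
        e x - φ.toSeries S b ∈ wordIdeal ha (p : S) k :=
  AdicCompletion.exists_ringEquiv _ (φ.toSeries S) (wordIdeal ha (p : S))
    (wordIdeal_antitone ha _) (φ.comap_wordIdeal ha p) (φ.exists_sub_mem_wordIdeal ha _)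
    (eq_zero_of_mem_wordIdeal ha hS) (exists_limit_wordIdeal ha hS)

/-- The completed semigroup ring is the ring of power series with exponents in the semigroup. -/
def equiv (ha : ∀ j, a j ≠ 0) (p : ℕ) (hS : IsAdicComplete (Ideal.span {(p : S)}) S) :
    CompletedSemigroupRing p S g ≃+* supportedPowerSeries (affineSemigroup a) S :=
  Classical.choose (φ.exists_equiv ha p hS)

theorem equiv_sub_mem (ha : ∀ j, a j ≠ 0) (p : ℕ) (hS : IsAdicComplete (Ideal.span {(p : S)}) S)
    {x : CompletedSemigroupRing p S g} {k : ℕ} {b : AddMonoidAlgebra S M}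
    (hx : AdicCompletion.evalₐ (semigroupIdeal p S g) k x = Ideal.Quotient.mk _ b) :
    φ.equiv ha p hS x - φ.toSeries S b ∈ wordIdeal ha (p : S) k :=
  Classical.choose_spec (φ.exists_equiv ha p hS) x k b hx

theorem toSeries_semigroupRingMap (f : S →+* S') (ψ : M →+ M') {k : ℕ} (hk : k ≠ 0)
    (hg : ∀ j, ψ (g j) = k • g' j) (x : AddMonoidAlgebra S M) :
    φ'.toSeries S' (semigroupRingMap f ψ x) = expandMap k hk f (φ.toSeries S x) := by
  rw [← AddMonoidAlgebra.sum_coeff_single x]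
  simp only [Finsupp.sum, map_sum]
  refine Finset.sum_congr rfl fun m _ => ?_
  rw [semigroupRingMap_single]
  refine Subtype.ext ?_
  rw [coe_expandMap]
  change ((AddMonoidAlgebra.mapDomain φ'.toHom (AddMonoidAlgebra.single (ψ m) (f (x.coeff m))) :
    MvPolynomial (Fin n) S') : MvPowerSeries (Fin n) S') = MvPowerSeries.expand k hk
      (MvPowerSeries.map f ((AddMonoidAlgebra.mapDomain φ.toHom
        (AddMonoidAlgebra.single m (x.coeff m)) : MvPolynomial (Fin n) S)))
  rw [AddMonoidAlgebra.mapDomain_single, AddMonoidAlgebra.mapDomain_single,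
    φ.toHom_map φ' ψ k hg]
  change ((MvPolynomial.monomial _ _ : MvPolynomial (Fin n) S') : MvPowerSeries (Fin n) S') =
    MvPowerSeries.expand k hk (MvPowerSeries.map f
      ((MvPolynomial.monomial _ _ : MvPolynomial (Fin n) S)))
  rw [MvPolynomial.coe_monomial, MvPolynomial.coe_monomial, MvPowerSeries.map_monomial,
    MvPowerSeries.expand_monomial]

/-- For every `l`, both sides are congruent modulo the `l`-th word ideal to the image of one element
of the uncompleted ring representing `x` modulo the `l`-th power; the word ideals intersect in zero.
-/
theorem equiv_completedSemigroupRingMap (ha : ∀ j, a j ≠ 0) (p : ℕ)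
    (hS : IsAdicComplete (Ideal.span {(p : S)}) S)
    (hS' : IsAdicComplete (Ideal.span {(p : S')}) S') (f : S →+* S') (ψ : M →+ M') {k : ℕ}
    (hk : k ≠ 0) (hg : ∀ j, ψ (g j) = k • g' j) (x : CompletedSemigroupRing p S g) :
    φ'.equiv ha p hS' (completedSemigroupRingMap p f ψ g g' k hk hg x) =
      expandMap k hk f (φ.equiv ha p hS x) := by
  rw [← sub_eq_zero]
  refine eq_zero_of_mem_wordIdeal ha hS' _ fun l => ?_
  obtain ⟨b, hb⟩ := Ideal.Quotient.mk_surjective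
    (AdicCompletion.evalₐ (semigroupIdeal p S g) l x)
  have h1 := φ.equiv_sub_mem ha p hS hb.symm
  have h2 : AdicCompletion.evalₐ (semigroupIdeal p S' g') l
      (completedSemigroupRingMap p f ψ g g' k hk hg x) =
        Ideal.Quotient.mk _ (semigroupRingMap f ψ b) :=
    evalₐ_adicCompletionMap _ _ hb.symm
  have h3 := φ'.equiv_sub_mem ha p hS' h2
  rw [φ.toSeries_semigroupRingMap φ' f ψ hk hg] at h3
  have h4 := expandMap_mem_wordIdeal ha hk f _ h1
  rw [map_natCast, map_sub] at h4
  have := sub_mem h3 h4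
  rwa [sub_sub_sub_cancel_right] at this

end SemigroupChart

/-! ### Towers whose reductions are truncations of one ring of characteristic `p` -/

namespace RingTower

/-- The reductions modulo `p` of the tower `T` are the truncations `E / τ^{p^i}` of a ring `E` of
characteristic `p`, with the `p`-th power maps as transition maps. -/
structure FrobeniusModel (p : ℕ) (T : RingTower.{u}) (E : Type v) [CommRing E] (τ : E) where
  p_eq_zero : (p : E) = 0
  complete : IsAdicComplete (Ideal.span {τ}) E
  -- For `m = p^i` this says that the Frobenius induces an injection `E/τ^{p^i} → E/τ^{p^{i+1}}`.
  dvd_of_dvd_pow : ∀ m y, τ ^ (m * p) ∣ y ^ p → τ ^ m ∣ y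
  /-- the reduction maps -/
  red : ∀ i, T.obj i →+* E ⧸ Ideal.span {τ ^ p ^ i}
  red_surjective : ∀ i, Function.Surjective (red i)
  ker_red : ∀ i, RingHom.ker (red i) = Ideal.span {(p : T.obj i)}
  red_map : ∀ i x y, red i x = Ideal.Quotient.mk _ y →
    red (i + 1) (T.map i x) = Ideal.Quotient.mk _ (y ^ p)
  /-- the `p`-th root of `p` in the term with index one -/
  root : T.obj 1
  root_pow : root ^ p = p
  red_root : red 1 root = Ideal.Quotient.mk _ τ
  zariskian : ∀ i, Ideal.span {(p : T.obj i)} ≤ Ideal.jacobson ⊥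
  p_mem : ∀ i, (p : T.obj i) ∈ nonZeroDivisors (T.obj i)

namespace FrobeniusModel

variable {p : ℕ} {T : RingTower.{u}} {E : Type v} [CommRing E] {τ : E}
  (D : FrobeniusModel p T E τ) {R : Type*} [CommRing R] (e : R →+* T.obj 0)

theorem baseIdeal_span (T : RingTower.{u}) (e : R →+* T.obj 0) (i : ℕ) :
    T.baseIdeal e (Ideal.span {(p : R)}) i = Ideal.span {(p : T.obj i)} := by
  rw [baseIdeal, Ideal.map_span, Set.image_singleton, map_natCast]

/-- The isomorphism of the reduction of the `i`-th term with `E / τ^{p^i}`. -/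
def quotEquiv (i : ℕ) :
    T.Quot e (Ideal.span {(p : R)}) i ≃+* E ⧸ Ideal.span {τ ^ p ^ i} :=
  (Ideal.quotEquivOfEq ((baseIdeal_span T e i).trans (D.ker_red i).symm)).trans
    (RingHom.quotientKerEquivOfSurjective (D.red_surjective i))

theorem quotEquiv_mk (i : ℕ) (x : T.obj i) :
    D.quotEquiv e i (Ideal.Quotient.mk _ x) = D.red i x := rfl

theorem mk_eq_mk_iff (i : ℕ) (x y : E) :
    (Ideal.Quotient.mk (Ideal.span {τ ^ p ^ i}) x = Ideal.Quotient.mk _ y) ↔ τ ^ p ^ i ∣ x - y := by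
  rw [Ideal.Quotient.eq, Ideal.mem_span_singleton]

theorem quotEquiv_quotMap (i : ℕ) (z : T.Quot e (Ideal.span {(p : R)}) i) (y : E)
    (h : D.quotEquiv e i z = Ideal.Quotient.mk _ y) :
    D.quotEquiv e (i + 1) (T.quotMap e _ i z) = Ideal.Quotient.mk _ (y ^ p) := by
  obtain ⟨x, rfl⟩ := Ideal.Quotient.mk_surjective z
  rw [quotEquiv_mk] at h
  rw [quotMap, Ideal.quotientMap_mk, quotEquiv_mk]
  exact D.red_map i x y h

include D in
theorem isPurelyInseparable (he : Function.Bijective e) :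
    T.IsPurelyInseparable p e (Ideal.span {(p : R)}) where
  bijective := he
  p_mem := Ideal.mem_span_singleton_self _
  quotMap_injective i := by
    rw [injective_iff_map_eq_zero]
    intro z hz
    obtain ⟨y, hy⟩ := Ideal.Quotient.mk_surjective (D.quotEquiv e i z)
    have h1 := D.quotEquiv_quotMap e i z y hy.symm
    rw [hz, map_zero, ← map_zero (Ideal.Quotient.mk _), eq_comm, mk_eq_mk_iff, sub_zero,
      pow_succ] at h1
    have h2 := D.dvd_of_dvd_pow _ _ h1
    rw [← map_eq_zero_iff (D.quotEquiv e i) (D.quotEquiv e i).injective, ← hy,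
      Ideal.Quotient.eq_zero_iff_dvd]
    exact h2
  frobenius_mem i z := by
    obtain ⟨y, hy⟩ := Ideal.Quotient.mk_surjective (D.quotEquiv e (i + 1) z)
    refine ⟨(D.quotEquiv e i).symm (Ideal.Quotient.mk _ y), (D.quotEquiv e (i + 1)).injective ?_⟩
    rw [D.quotEquiv_quotMap e i _ y (RingEquiv.apply_symm_apply _ _), map_pow, map_pow, hy]

include D in
theorem powerTorsionElements_eq (i : ℕ) :
    (T.baseIdeal e (Ideal.span {(p : R)}) i).powerTorsionElements = {0} := by
  rw [baseIdeal_span]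
  ext x
  constructor
  · rintro ⟨k, hk⟩
    have := hk _ (Ideal.pow_mem_pow (Ideal.mem_span_singleton_self _) k)
    exact (mul_left_mem_nonZeroDivisors_eq_zero_iff (pow_mem (D.p_mem i) k)).mp this
  · rintro rfl
    exact ⟨0, fun y _ => mul_zero y⟩

include D in
theorem torsionElements_eq (i : ℕ) :
    (T.baseIdeal e (Ideal.span {(p : R)}) i).torsionElements = {0} := by
  rw [baseIdeal_span]
  ext x
  constructor
  · intro hx
    exact (mul_left_mem_nonZeroDivisors_eq_zero_iff (D.p_mem i)).mp
      (hx _ (Ideal.mem_span_singleton_self _))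
  · rintro rfl y _
    exact mul_zero y

/-- The root reduces to `τ` in the term of index one, and each further transition map raises it to
the `p`-th power. -/
theorem red_fromOne_root (i : ℕ) :
    D.red (i + 1) (T.fromOne i D.root) = Ideal.Quotient.mk _ (τ ^ p ^ i) := by
  induction i with
  | zero =>
    exact D.red_root.trans (congrArg _ (by rw [pow_zero, pow_one]))
  | succ i ih =>
    change D.red (i + 1 + 1) (T.map (i + 1) (T.fromOne i D.root)) = _
    rw [D.red_map (i + 1) _ _ ih, ← pow_mul, ← pow_succ]

variable [Fact p.Prime] {e}

/-- In the model, `F_i` is the canonical projection `E/τ^{p^{i+1}} → E/τ^{p^i}`: following the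
projection by the injective transition map also gives `y ↦ y^p`. -/
theorem quotEquiv_frobProj (h : T.IsPurelyInseparable p e (Ideal.span {(p : R)})) (i : ℕ)
    (z : T.Quot e (Ideal.span {(p : R)}) (i + 1)) (y : E)
    (hz : D.quotEquiv e (i + 1) z = Ideal.Quotient.mk _ y) :
    D.quotEquiv e i (h.frobProj i z) = Ideal.Quotient.mk _ y := by
  rw [← RingEquiv.eq_symm_apply]
  refine h.quotMap_injective i ((D.quotEquiv e (i + 1)).injective ?_)
  rw [h.quotMap_frobProj, D.quotEquiv_quotMap e i _ y (RingEquiv.apply_symm_apply _ _), map_pow,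
    hz, map_pow]

theorem ker_frobProj (h : T.IsPurelyInseparable p e (Ideal.span {(p : R)})) (i : ℕ) :
    RingHom.ker (h.frobProj i) = (Ideal.span {D.root}).map
      ((Ideal.Quotient.mk (T.baseIdeal e (Ideal.span {(p : R)}) (i + 1))).comp (T.fromOne i)) := by
  have hroot : D.quotEquiv e (i + 1) (Ideal.Quotient.mk _ (T.fromOne i D.root)) =
      Ideal.Quotient.mk _ (τ ^ p ^ i) := D.red_fromOne_root i
  ext z
  obtain ⟨y, hy⟩ := Ideal.Quotient.mk_surjective (D.quotEquiv e (i + 1) z)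
  rw [Ideal.map_span, Set.image_singleton, Ideal.mem_span_singleton, RingHom.mem_ker,
    ← map_eq_zero_iff (D.quotEquiv e i) (D.quotEquiv e i).injective,
    D.quotEquiv_frobProj h i z y hy.symm, Ideal.Quotient.eq_zero_iff_dvd, RingHom.comp_apply]
  constructor
  · rintro ⟨w, rfl⟩
    refine ⟨(D.quotEquiv e (i + 1)).symm (Ideal.Quotient.mk _ w),
      (D.quotEquiv e (i + 1)).injective ?_⟩
    rw [map_mul, hroot, RingEquiv.apply_symm_apply, ← hy, map_mul]
  · rintro ⟨w, rfl⟩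
    obtain ⟨v, hv⟩ := Ideal.Quotient.mk_surjective (D.quotEquiv e (i + 1) w)
    rw [map_mul, hroot, ← hv, ← map_mul, mk_eq_mk_iff] at hy
    -- The congruence `hy` holds modulo `τ^{p^{i+1}}`, hence modulo `τ^{p^i}`, where the multiple of
    -- the root vanishes.
    have h1 := (pow_dvd_pow τ (Nat.pow_le_pow_right (Fact.out : p.Prime).pos i.le_succ)).trans hy
    exact (dvd_sub_left (dvd_mul_right _ _)).mp h1

include D in
theorem isPerfectoid (he : Function.Bijective e) :
    T.IsPerfectoid p e (Ideal.span {(p : R)}) where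
  toIsPurelyInseparable := D.isPurelyInseparable e he
  frobProj_surjective i z := by
    obtain ⟨y, hy⟩ := Ideal.Quotient.mk_surjective (D.quotEquiv e i z)
    refine ⟨(D.quotEquiv e (i + 1)).symm (Ideal.Quotient.mk _ y), (D.quotEquiv e i).injective ?_⟩
    rw [D.quotEquiv_frobProj _ i _ y (RingEquiv.apply_symm_apply _ _), hy]
  zariskian i := by
    rw [Ideal.IsZariskian, baseIdeal_span]
    exact D.zariskian i
  principal := ⟨⟨_, rfl⟩⟩
  pillar := by
    refine ⟨Ideal.span {D.root}, ⟨⟨_, rfl⟩⟩, ?_, D.ker_frobProj _⟩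
    rw [baseIdeal_span, Ideal.frobeniusPower]
    apply le_antisymm
    · refine Ideal.span_le.mpr ?_
      rintro _ ⟨x, hx, rfl⟩
      obtain ⟨c, rfl⟩ := Ideal.mem_span_singleton.mp hx
      rw [SetLike.mem_coe, Ideal.mem_span_singleton, mul_pow, D.root_pow]
      exact dvd_mul_right _ _
    · refine Ideal.span_le.mpr (Set.singleton_subset_iff.mpr (Ideal.subset_span ?_))
      exact ⟨D.root, Ideal.mem_span_singleton_self _, D.root_pow.symm⟩
  torsion i := by rw [D.powerTorsionElements_eq, D.torsionElements_eq]
  torsion_frobenius i := by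
    have h0 : ∀ i (x : (T.baseIdeal e (Ideal.span {(p : R)}) i).powerTorsionElements),
        x.1 = 0 := fun i x =>
      Set.mem_singleton_iff.mp ((D.powerTorsionElements_eq e i).le x.2)
    -- Since `p` is a nonzerodivisor, both torsion sets are `{0}` and the zero map is the required
    -- bijection.
    refine ⟨fun _ => ⟨0, by rw [D.powerTorsionElements_eq]; rfl⟩, ⟨?_, ?_⟩, fun x => ?_⟩
    · exact fun x y _ => Subtype.ext ((h0 _ x).trans (h0 _ y).symm)
    · exact fun y => ⟨⟨0, by rw [D.powerTorsionElements_eq]; rfl⟩, Subtype.ext (h0 _ y).symm⟩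
    · rw [h0 _ x, map_zero, map_zero, map_zero]

/-- The map from `E` to the `i`-th term of the tilt. -/
def toSmallTilt (h : T.IsPurelyInseparable p e (Ideal.span {(p : R)})) (i : ℕ) :
    E →+* h.smallTilt i :=
  RingHom.codRestrict
    (RingHom.pi fun m : {m : ℕ // i ≤ m} => ((D.quotEquiv e m.1).symm.toRingHom.comp
      (Ideal.Quotient.mk (Ideal.span {τ ^ p ^ m.1})))) _ (fun y m hm => by
      refine (D.quotEquiv e m).injective ?_
      refine (D.quotEquiv_frobProj h m _ y (RingEquiv.apply_symm_apply _ _)).trans ?_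
      exact (RingEquiv.apply_symm_apply _ _).symm)

theorem quotEquiv_toSmallTilt (h : T.IsPurelyInseparable p e (Ideal.span {(p : R)})) (i : ℕ)
    (y : E) (m : {m : ℕ // i ≤ m}) :
    D.quotEquiv e m.1 ((D.toSmallTilt h i y).1 m) = Ideal.Quotient.mk _ y :=
  RingEquiv.apply_symm_apply _ _

/-- The small tilt is the limit of the quotients `E/τ^{p^m}` for `m ≥ i` along the projections. The
exponents `p^m` are cofinal, so this limit is `E` by completeness. -/
theorem toSmallTilt_bijective (h : T.IsPurelyInseparable p e (Ideal.span {(p : R)})) (i : ℕ) :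
    Function.Bijective (D.toSmallTilt h i) := by
  have hp : 1 < p := (Fact.out : p.Prime).one_lt
  obtain ⟨hhaus, hprec⟩ := (isAdicComplete_span_singleton_iff τ).mp D.complete
  constructor
  · rw [injective_iff_map_eq_zero]
    intro y hy
    refine hhaus y fun k => ?_
    have h1 := D.quotEquiv_toSmallTilt h i y ⟨i + k, Nat.le_add_right i k⟩
    rw [hy] at h1
    have h2 : Ideal.Quotient.mk (Ideal.span {τ ^ p ^ (i + k)}) y = 0 :=
      h1.symm.trans (map_zero _)
    rw [Ideal.Quotient.eq_zero_iff_dvd] at h2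
    exact (pow_dvd_pow τ ((Nat.le_add_left k i).trans (Nat.lt_pow_self hp).le)).trans h2
  · intro x
    choose y hy using fun m : {m : ℕ // i ≤ m} =>
      Ideal.Quotient.mk_surjective (D.quotEquiv e m.1 (x.1 m))
    have hstep : ∀ m (hm : i ≤ m), τ ^ p ^ m ∣ y ⟨m + 1, hm.trans m.le_succ⟩ - y ⟨m, hm⟩ := by
      intro m hm
      have h1 := D.quotEquiv_frobProj h m _ _ (hy ⟨m + 1, hm.trans m.le_succ⟩).symm
      rw [x.2 m hm] at h1
      exact (mk_eq_mk_iff m _ _).mp ((hy ⟨m, hm⟩).trans h1).symm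
    -- The estimate `k ≤ i + k < p^{i+k}` weakens the congruences modulo `τ^{p^{i+k}}` to
    -- congruences modulo `τ^k`.
    obtain ⟨L, hL⟩ := hprec (fun k => y ⟨i + k, Nat.le_add_right i k⟩) fun k =>
      (pow_dvd_pow τ ((Nat.le_add_left k i).trans (Nat.lt_pow_self hp).le)).trans
        (hstep (i + k) (Nat.le_add_right i k))
    refine ⟨L, Subtype.ext (funext fun m => (D.quotEquiv e m.1).injective ?_)⟩
    obtain ⟨m, hm⟩ := m
    have hfar : ∀ l (hl : m ≤ l), τ ^ p ^ m ∣ y ⟨l, hm.trans hl⟩ - y ⟨m, hm⟩ := by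
      intro l hl
      induction l, hl using Nat.le_induction with
      | base => simp
      | succ l hl ih =>
        have h1 := (pow_dvd_pow τ (Nat.pow_le_pow_right hp.le hl)).trans (hstep l (hm.trans hl))
        simpa using dvd_add h1 ih
    -- The representative of index `i + p^m` is congruent modulo `τ^{p^m}` both to `y_m` and to the
    -- limit `L`.
    have h1 := hfar (i + p ^ m) ((Nat.lt_pow_self hp).le.trans (Nat.le_add_left _ _))
    have h2 := dvd_sub h1 (hL (p ^ m))
    rw [sub_sub_sub_cancel_left] at h2
    rw [D.quotEquiv_toSmallTilt, ← hy, mk_eq_mk_iff]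
    exact h2

include D in
-- Identifying each small tilt with `E` makes the tilt's transition maps the Frobenius of `E`. Any
-- tower with the same description is therefore isomorphic to the tilt.
theorem tilt_isIsomorphic (h : T.IsPerfectoid p e (Ideal.span {(p : R)}))
    (T' : RingTower) (f : ∀ i, T'.obj i ≃+* E) (hf : ∀ i x, f (i + 1) (T'.map i x) = f i x ^ p) :
    h.tilt.IsIsomorphic T' := by
  let g : ∀ i, E ≃+* h.toIsPurelyInseparable.smallTilt i := fun i =>
    RingEquiv.ofBijective _ (D.toSmallTilt_bijective h.toIsPurelyInseparable i)
  refine ⟨fun i => (g i).symm.trans (f i).symm, fun i x => ?_⟩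
  obtain ⟨y, rfl⟩ := (g i).surjective x
  obtain ⟨z, rfl⟩ := (f i).surjective y
  have key : h.toIsPurelyInseparable.tiltMap i (g i (f i z)) = g (i + 1) (f i z ^ p) := by
    refine Subtype.ext (funext ?_)
    rintro ⟨_ | m, hm⟩
    · exact absurd hm (Nat.not_succ_le_zero i)
    · refine (D.quotEquiv e (m + 1)).injective ?_
      refine (D.quotEquiv_quotMap e m _ (f i z) ?_).trans
        (D.quotEquiv_toSmallTilt h.toIsPurelyInseparable (i + 1) _ ⟨m + 1, hm⟩).symm
      exact D.quotEquiv_toSmallTilt h.toIsPurelyInseparable i _ ⟨m, Nat.le_of_succ_le_succ hm⟩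
  change (f (i + 1)).symm ((g (i + 1)).symm (h.toIsPurelyInseparable.tiltMap i (g i (f i z)))) =
    T'.map i ((f i).symm ((g i).symm (g i (f i z))))
  rw [key, RingEquiv.symm_apply_apply, RingEquiv.symm_apply_apply, RingEquiv.symm_apply_apply,
    RingEquiv.symm_apply_eq, hf]

end FrobeniusModel

end RingTower

/-! ### The rings obtained by adjoining a root of `p` to the `p`-adic integers -/

theorem isAdicComplete_of_basis {A B ι : Type*} [CommRing A] [CommRing B] [Algebra A B]
    [Finite ι] (b : Module.Basis ι A B) (c : A) (hc : IsAdicComplete (Ideal.span {c}) A) :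
    IsAdicComplete (Ideal.span {algebraMap A B c}) B := by
  have := Fintype.ofFinite ι
  have key : ∀ (k : ℕ) (x : B), algebraMap A B c ^ k ∣ x ↔ ∀ j, c ^ k ∣ b.repr x j := by
    intro k x
    rw [← map_pow]
    constructor
    · rintro ⟨y, rfl⟩ j
      rw [← Algebra.smul_def, map_smul, Finsupp.smul_apply, smul_eq_mul]
      exact dvd_mul_right _ _
    · intro H
      choose y hy using H
      refine ⟨b.equivFun.symm y, b.repr.injective (Finsupp.ext fun j => ?_)⟩
      rw [← Algebra.smul_def, map_smul, Finsupp.smul_apply, hy, smul_eq_mul,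
        ← b.equivFun_apply, LinearEquiv.apply_symm_apply]
  rw [isAdicComplete_span_singleton_iff] at hc ⊢
  simp only [key, map_sub, Finsupp.sub_apply]
  refine ⟨fun x hx => b.repr.injective (Finsupp.ext fun j => ?_), fun f hf => ?_⟩
  · rw [map_zero]
    exact hc.1 _ fun k => hx k j
  · choose L hL using fun j => hc.2 (fun k => b.repr (f k) j) fun k => hf k j
    refine ⟨b.equivFun.symm L, fun k j => ?_⟩
    rw [← b.equivFun_apply (b.equivFun.symm L), LinearEquiv.apply_symm_apply]
    exact hL j k

section AdjoinRoot

open Polynomial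

variable {p : ℕ} [hp : Fact p.Prime]

theorem PadicInt.isAdicComplete_span_p : IsAdicComplete (Ideal.span {(p : ℤ_[p])}) ℤ_[p] :=
  PadicInt.maximalIdeal_eq_span_p (p := p) ▸ inferInstance

theorem PadicInt.toZMod_eq_zero_iff (x : ℤ_[p]) : PadicInt.toZMod x = 0 ↔ (p : ℤ_[p]) ∣ x := by
  rw [← RingHom.mem_ker, PadicInt.ker_toZMod, PadicInt.maximalIdeal_eq_span_p,
    Ideal.mem_span_singleton]

instance : FaithfulSMul ℤ_[p] (AlgebraicClosure ℚ_[p]) :=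
  (faithfulSMul_iff_algebraMap_injective _ _).mpr <| by
    rw [IsScalarTower.algebraMap_eq ℤ_[p] ℚ_[p]]
    exact (algebraMap ℚ_[p] _).injective.comp (IsFractionRing.injective ℤ_[p] ℚ_[p])

/-- Eisenstein's criterion at the prime ideal `(p)`. -/
theorem irreducible_X_pow_sub_p {N : ℕ} (hN : N ≠ 0) :
    Irreducible (X ^ N - C (p : ℤ_[p]) : ℤ_[p][X]) := by
  have hprime : Prime (p : ℤ_[p]) := PadicInt.prime_p
  have hmonic : (X ^ N - C (p : ℤ_[p]) : ℤ_[p][X]).Monic := monic_X_pow_sub_C _ hN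
  have hdeg : (X ^ N - C (p : ℤ_[p]) : ℤ_[p][X]).natDegree = N := natDegree_X_pow_sub_C
  have hideal : (Ideal.span {(p : ℤ_[p])}).IsPrime :=
    (Ideal.span_singleton_prime hprime.ne_zero).mpr hprime
  refine IsEisensteinAt.irreducible (𝓟 := Ideal.span {(p : ℤ_[p])})
    ⟨?_, ?_, ?_⟩ hideal hmonic.isPrimitive
    (hdeg.symm ▸ Nat.pos_of_ne_zero hN)
  · rw [hmonic.leadingCoeff]
    exact fun h1 => hideal.ne_top ((Ideal.eq_top_iff_one _).mpr h1)
  · intro m hm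
    rw [hdeg] at hm
    rw [coeff_sub, coeff_X_pow, if_neg hm.ne, zero_sub, coeff_C]
    split_ifs with h0
    · exact neg_mem (Ideal.mem_span_singleton_self _)
    · simp
  · rw [coeff_sub, coeff_X_pow, if_neg hN.symm, zero_sub, coeff_C_zero, neg_mem_iff,
      Ideal.span_singleton_pow, Ideal.mem_span_singleton]
    intro h
    have := (pow_dvd_pow_iff hprime.ne_zero hprime.not_isUnit (n := 2) (m := 1)).mp
      (by simpa using h)
    omega

variable {w : AlgebraicClosure ℚ_[p]} {N : ℕ}

theorem minpoly_eq_X_pow_sub_p (hN : N ≠ 0) (hw : w ^ N = (p : AlgebraicClosure ℚ_[p])) :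
    IsIntegral ℤ_[p] w ∧ minpoly ℤ_[p] w = X ^ N - C (p : ℤ_[p]) := by
  have hmonic : (X ^ N - C (p : ℤ_[p]) : ℤ_[p][X]).Monic := monic_X_pow_sub_C _ hN
  have hroot : aeval w (X ^ N - C (p : ℤ_[p]) : ℤ_[p][X]) = 0 := by simp [hw]
  have hint : IsIntegral ℤ_[p] w := ⟨_, hmonic, by simpa [aeval_def] using hroot⟩
  refine ⟨hint, eq_of_monic_of_associated (minpoly.monic hint) hmonic ?_⟩
  exact (minpoly.irreducible hint).associated_of_dvd (irreducible_X_pow_sub_p hN)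
    (minpoly.isIntegrallyClosed_dvd hint hroot)

theorem isAdicComplete_adjoin (hN : N ≠ 0) (hw : w ^ N = (p : AlgebraicClosure ℚ_[p])) :
    IsAdicComplete (Ideal.span {(p : Algebra.adjoin ℤ_[p] {w})}) (Algebra.adjoin ℤ_[p] {w}) := by
  have := isAdicComplete_of_basis
    (Algebra.adjoin.powerBasis' (minpoly_eq_X_pow_sub_p hN hw).1).basis (p : ℤ_[p])
    PadicInt.isAdicComplete_span_p
  rwa [map_natCast] at this

/-- The evaluation map from polynomials to the ring obtained by adjoining `w`. -/
def evalAdjoin (w : AlgebraicClosure ℚ_[p]) : ℤ_[p][X] →ₐ[ℤ_[p]] Algebra.adjoin ℤ_[p] {w} :=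
  aeval ⟨w, Algebra.self_mem_adjoin_singleton ℤ_[p] w⟩

theorem coe_evalAdjoin (f : ℤ_[p][X]) : (evalAdjoin w f : AlgebraicClosure ℚ_[p]) = aeval w f := by
  rw [evalAdjoin, ← Subalgebra.coe_val, ← aeval_algHom_apply]
  rfl

theorem evalAdjoin_surjective : Function.Surjective (evalAdjoin w) := by
  rintro ⟨x, hx⟩
  rw [Algebra.adjoin_singleton_eq_range_aeval] at hx
  obtain ⟨f, rfl⟩ := hx
  exact ⟨f, Subtype.ext (coe_evalAdjoin f)⟩

/-- Reduction of polynomials to truncated power series over `𝔽_p`. -/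
def truncMap (p : ℕ) [Fact p.Prime] (N : ℕ) :
    ℤ_[p][X] →+* PowerSeries (ZMod p) ⧸ Ideal.span {(PowerSeries.X : PowerSeries (ZMod p)) ^ N} :=
  (Ideal.Quotient.mk _).comp (coeToPowerSeries.ringHom.comp (mapRingHom PadicInt.toZMod))

theorem truncMap_eq_zero_iff (f : ℤ_[p][X]) :
    truncMap p N f = 0 ↔ ∀ m < N, (p : ℤ_[p]) ∣ f.coeff m := by
  change Ideal.Quotient.mk _ ((f.map PadicInt.toZMod : (ZMod p)[X]) : PowerSeries (ZMod p)) = 0 ↔ _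
  rw [Ideal.Quotient.eq_zero_iff_dvd, PowerSeries.X_pow_dvd_iff]
  simp only [coeff_coe, coeff_map, PadicInt.toZMod_eq_zero_iff]

theorem truncMap_surjective : Function.Surjective (truncMap p N) := by
  intro y
  obtain ⟨g, rfl⟩ := Ideal.Quotient.mk_surjective y
  obtain ⟨f, hf⟩ := Polynomial.map_surjective (PadicInt.toZMod (p := p))
    (ZMod.ringHom_surjective _) (PowerSeries.trunc N g)
  refine ⟨f, ?_⟩
  change Ideal.Quotient.mk _ ((f.map PadicInt.toZMod : (ZMod p)[X]) : PowerSeries (ZMod p)) = _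
  rw [hf, Ideal.Quotient.eq, Ideal.mem_span_singleton, PowerSeries.X_pow_dvd_iff]
  intro m hm
  rw [map_sub, coeff_coe, PowerSeries.coeff_trunc, if_pos hm, sub_self]

theorem evalAdjoin_pow (hw : w ^ N = (p : AlgebraicClosure ℚ_[p])) :
    evalAdjoin w X ^ N = (p : Algebra.adjoin ℤ_[p] {w}) :=
  Subtype.ext (by simpa [coe_evalAdjoin] using hw)

/-- As `w^N = p`, the terms of degree at least `N` become divisible by `p` after evaluation.
Conversely, polynomials vanishing at `w` are multiples of `X^N - p`, which `truncMap` kills. So both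
conditions describe the ideal `(p, X^N)`. -/
theorem truncMap_eq_zero_iff_dvd (hN : N ≠ 0) (hw : w ^ N = (p : AlgebraicClosure ℚ_[p]))
    (f : ℤ_[p][X]) :
    truncMap p N f = 0 ↔ (p : Algebra.adjoin ℤ_[p] {w}) ∣ evalAdjoin w f := by
  have hdvd : ∀ f : ℤ_[p][X], truncMap p N f = 0 →
      (p : Algebra.adjoin ℤ_[p] {w}) ∣ evalAdjoin w f := by
    intro f hf
    rw [truncMap_eq_zero_iff] at hf
    rw [f.as_sum_range_C_mul_X_pow, map_sum]
    refine Finset.dvd_sum fun m _ => ?_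
    rw [map_mul, map_pow]
    rcases lt_or_ge m N with hm | hm
    · obtain ⟨d, hd⟩ := hf m hm
      rw [hd, C_mul, map_natCast, map_mul, map_natCast, mul_assoc]
      exact dvd_mul_right _ _
    · rw [← Nat.sub_add_cancel hm, pow_add, evalAdjoin_pow hw]
      exact (dvd_mul_left _ _).mul_left _
  have hker : ∀ f : ℤ_[p][X], evalAdjoin w f = 0 → truncMap p N f = 0 := by
    intro f hf
    obtain ⟨hint, hmin⟩ := minpoly_eq_X_pow_sub_p hN hw
    obtain ⟨g, rfl⟩ := minpoly.isIntegrallyClosed_dvd hint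
      (show aeval w f = 0 by rw [← coe_evalAdjoin, hf]; rfl)
    have : truncMap p N (X ^ N - C (p : ℤ_[p])) = 0 := by
      rw [truncMap_eq_zero_iff]
      intro m hm
      rw [coeff_sub, coeff_X_pow, if_neg hm.ne, zero_sub, coeff_C, dvd_neg]
      split_ifs
      · exact dvd_rfl
      · exact dvd_zero _
    rw [hmin, map_mul, this, zero_mul]
  refine ⟨hdvd f, ?_⟩
  rintro ⟨x, hx⟩
  obtain ⟨g, rfl⟩ := evalAdjoin_surjective x
  have h1 : truncMap p N (f - C (p : ℤ_[p]) * g) = 0 :=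
    hker _ (by rw [map_sub, map_mul, hx, map_natCast, map_natCast, sub_self])
  have h2 : truncMap p N (C (p : ℤ_[p])) = 0 := by
    rw [truncMap_eq_zero_iff]
    intro m _
    rw [coeff_C]
    split_ifs
    · exact dvd_rfl
    · exact dvd_zero _
  rwa [map_sub, map_mul, h2, zero_mul, sub_zero] at h1

theorem exists_adjoin_reduction (hN : N ≠ 0) (hw : w ^ N = (p : AlgebraicClosure ℚ_[p])) :
    ∃ α : Algebra.adjoin ℤ_[p] {w} →+* PowerSeries (ZMod p) ⧸
        Ideal.span {(PowerSeries.X : PowerSeries (ZMod p)) ^ N},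
      (∀ f, α (evalAdjoin w f) = truncMap p N f) ∧ Function.Surjective α ∧
        RingHom.ker α = Ideal.span {(p : Algebra.adjoin ℤ_[p] {w})} := by
  have hker : RingHom.ker (evalAdjoin w).toRingHom ≤ RingHom.ker (truncMap p N) := by
    intro f hf
    rw [RingHom.mem_ker, truncMap_eq_zero_iff_dvd hN hw, show evalAdjoin w f = 0 from hf]
    exact dvd_zero _
  obtain ⟨α, hα⟩ : ∃ α : Algebra.adjoin ℤ_[p] {w} →+* _,
      ∀ f, α (evalAdjoin w f) = truncMap p N f :=
    ⟨(evalAdjoin w).toRingHom.liftOfSurjective evalAdjoin_surjective ⟨truncMap p N, hker⟩,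
      fun f => RingHom.liftOfRightInverse_comp_apply _ _ _ _ f⟩
  refine ⟨α, hα, fun y => ?_, ?_⟩
  · obtain ⟨f, rfl⟩ := truncMap_surjective y
    exact ⟨_, hα f⟩
  · ext x
    obtain ⟨f, rfl⟩ := evalAdjoin_surjective x
    rw [RingHom.mem_ker, hα, truncMap_eq_zero_iff_dvd hN hw, Ideal.mem_span_singleton]

/-- The reduction of the ring obtained by adjoining an `N`-th root of `p` to the `p`-adic
integers. -/
def adjoinReduction (hN : N ≠ 0) (hw : w ^ N = (p : AlgebraicClosure ℚ_[p])) :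
    Algebra.adjoin ℤ_[p] {w} →+* PowerSeries (ZMod p) ⧸
      Ideal.span {(PowerSeries.X : PowerSeries (ZMod p)) ^ N} :=
  Classical.choose (exists_adjoin_reduction hN hw)

theorem adjoinReduction_evalAdjoin (hN : N ≠ 0) (hw : w ^ N = (p : AlgebraicClosure ℚ_[p]))
    (f : ℤ_[p][X]) : adjoinReduction hN hw (evalAdjoin w f) = truncMap p N f :=
  (Classical.choose_spec (exists_adjoin_reduction hN hw)).1 f

theorem adjoinReduction_surjective (hN : N ≠ 0) (hw : w ^ N = (p : AlgebraicClosure ℚ_[p])) :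
    Function.Surjective (adjoinReduction hN hw) :=
  (Classical.choose_spec (exists_adjoin_reduction hN hw)).2.1

theorem ker_adjoinReduction (hN : N ≠ 0) (hw : w ^ N = (p : AlgebraicClosure ℚ_[p])) :
    RingHom.ker (adjoinReduction hN hw) = Ideal.span {(p : Algebra.adjoin ℤ_[p] {w})} :=
  (Classical.choose_spec (exists_adjoin_reduction hN hw)).2.2

instance PowerSeries.instCharP {R : Type*} [CommRing R] [CharP R p] : CharP (PowerSeries R) p :=
  charP_of_injective_ringHom (f := PowerSeries.C) PowerSeries.C_injective p

/-- The `p`-th power map between truncated power series rings over `𝔽_p`. -/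
def truncFrobenius (p : ℕ) [hp : Fact p.Prime] {N N' : ℕ} (hN : N' = N * p) :
    (PowerSeries (ZMod p) ⧸ Ideal.span {(PowerSeries.X : PowerSeries (ZMod p)) ^ N}) →+*
      PowerSeries (ZMod p) ⧸ Ideal.span {(PowerSeries.X : PowerSeries (ZMod p)) ^ N'} :=
  Ideal.quotientMap _ (frobenius (PowerSeries (ZMod p)) p) (by
    rw [Ideal.span_singleton_le_iff_mem, Ideal.mem_comap, frobenius_def, ← pow_mul, ← hN]
    exact Ideal.mem_span_singleton_self _)

/-- It suffices to compare on `X` and on constants. The relation `w = w'^p` gives `X ↦ X^p`, and the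
`p`-th power map is the identity on `𝔽_p`. -/
theorem adjoinReduction_inclusion {w' : AlgebraicClosure ℚ_[p]} {N' : ℕ} (hN : N ≠ 0)
    (hw : w ^ N = (p : AlgebraicClosure ℚ_[p])) (hN' : N' ≠ 0)
    (hw' : w' ^ N' = (p : AlgebraicClosure ℚ_[p])) (hNN : N' = N * p) (hww : w' ^ p = w)
    (hle : Algebra.adjoin ℤ_[p] {w} ≤ Algebra.adjoin ℤ_[p] {w'}) :
    (adjoinReduction hN' hw').comp (Subalgebra.inclusion hle).toRingHom =
      (truncFrobenius p hNN).comp (adjoinReduction hN hw) := by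
  have hX : Subalgebra.inclusion hle (evalAdjoin w X) = evalAdjoin w' (X ^ p) :=
    Subtype.ext (by
      rw [Subalgebra.coe_inclusion, coe_evalAdjoin, coe_evalAdjoin]
      simpa using hww.symm)
  have hC : ∀ c, Subalgebra.inclusion hle (evalAdjoin w (C c)) = evalAdjoin w' (C c) :=
    fun c => Subtype.ext (by
      rw [Subalgebra.coe_inclusion, coe_evalAdjoin, coe_evalAdjoin, aeval_C, aeval_C])
  have key : ((adjoinReduction hN' hw').comp (Subalgebra.inclusion hle).toRingHom).comp
      (evalAdjoin w).toRingHom =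
        ((truncFrobenius p hNN).comp (adjoinReduction hN hw)).comp (evalAdjoin w).toRingHom := by
    refine Polynomial.ringHom_ext (fun c => ?_) ?_
    · change adjoinReduction hN' hw' (Subalgebra.inclusion hle (evalAdjoin w (C c))) =
        truncFrobenius p hNN (adjoinReduction hN hw (evalAdjoin w (C c)))
      rw [hC, adjoinReduction_evalAdjoin, adjoinReduction_evalAdjoin]
      change Ideal.Quotient.mk _ (((C c).map PadicInt.toZMod : (ZMod p)[X]) :
        PowerSeries (ZMod p)) = Ideal.Quotient.mk _ ((((C c).map PadicInt.toZMod : (ZMod p)[X]) :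
          PowerSeries (ZMod p)) ^ p)
      rw [Polynomial.map_C, coe_C, ← map_pow, ZMod.pow_card]
    · change adjoinReduction hN' hw' (Subalgebra.inclusion hle (evalAdjoin w X)) =
        truncFrobenius p hNN (adjoinReduction hN hw (evalAdjoin w X))
      rw [hX, adjoinReduction_evalAdjoin, adjoinReduction_evalAdjoin]
      change Ideal.Quotient.mk _ (((X ^ p).map PadicInt.toZMod : (ZMod p)[X]) :
        PowerSeries (ZMod p)) = Ideal.Quotient.mk _ (((X.map PadicInt.toZMod : (ZMod p)[X]) :
          PowerSeries (ZMod p)) ^ p)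
      rw [Polynomial.map_pow, coe_pow]
  refine RingHom.ext fun x => ?_
  obtain ⟨f, rfl⟩ := evalAdjoin_surjective x
  exact RingHom.congr_fun key f

end AdjoinRoot

/-! ### The charts of the affine semigroup and of its roots -/

section Charts

variable {n r : ℕ}

/-- The inclusion of the affine semigroup. -/
def affineChart (a : Fin r → Fin n →₀ ℕ) : SemigroupChart a (affineGen a) where
  toHom := (affineSemigroup a).subtype
  injective := Subtype.val_injective
  map_gen _ := rfl
  closure_eq_top := by
    rw [← AddSubmonoid.closure_closure_coe_preimage]
    congr 1
    ext x
    simp [affineGen, Subtype.ext_iff]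

theorem castVec_injective (n : ℕ) : Function.Injective (castVec n) :=
  Finsupp.mapRange_injective _ (map_zero _) Nat.cast_injective

variable (p : ℕ) [hp : Fact p.Prime] (a : Fin r → Fin n →₀ ℕ) (i : ℕ)

theorem pow_nsmul_rootVec (j : Fin r) : p ^ i • rootVec p a i j = castVec n (a j) := by
  have hp0 : (p : ℚ≥0) ≠ 0 := Nat.cast_ne_zero.mpr hp.out.ne_zero
  rw [rootVec, ← Nat.cast_smul_eq_nsmul ℚ≥0, smul_smul, Nat.cast_pow, mul_one_div_cancel, one_smul]
  exact pow_ne_zero _ hp0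

theorem exists_castVec_eq (x : rootSemigroup p a i) : ∃ h, castVec n h = p ^ i • x.1 := by
  have h1 : rootSemigroup p a i ≤
      (AddMonoidHom.mrange (castVec n)).comap (nsmulAddMonoidHom (p ^ i)) := by
    refine AddSubmonoid.closure_le.mpr ?_
    rintro _ ⟨j, rfl⟩
    exact ⟨a j, (pow_nsmul_rootVec p a i j).symm⟩
  exact h1 x.2

/-- Multiplication by `p^i`, as an embedding of `H^{1/p^i}` into `ℕⁿ`. -/
def rootScale : rootSemigroup p a i →+ (Fin n →₀ ℕ) where
  toFun x := Classical.choose (exists_castVec_eq p a i x)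
  map_zero' := castVec_injective n (by
    rw [Classical.choose_spec (exists_castVec_eq p a i 0)]; simp)
  map_add' x y := castVec_injective n (by
    rw [map_add, Classical.choose_spec (exists_castVec_eq p a i (x + y)),
      Classical.choose_spec (exists_castVec_eq p a i x),
      Classical.choose_spec (exists_castVec_eq p a i y), ← smul_add]
    rfl)

theorem castVec_rootScale (x : rootSemigroup p a i) :
    castVec n (rootScale p a i x) = p ^ i • x.1 :=
  Classical.choose_spec (exists_castVec_eq p a i x)

/-- The chart of `H^{1/p^i}` given by multiplication by `p^i`. -/
def rootChart : SemigroupChart a (rootGen p a i) where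
  toHom := rootScale p a i
  injective x y hxy := by
    have h1 := congrArg (castVec n) hxy
    rw [castVec_rootScale, castVec_rootScale] at h1
    refine Subtype.ext (Finsupp.ext fun l => ?_)
    have h2 := DFunLike.congr_fun h1 l
    have hp0 : (p : ℚ≥0) ≠ 0 := Nat.cast_ne_zero.mpr hp.out.ne_zero
    simpa [hp0] using h2
  map_gen j := castVec_injective n (by
    rw [castVec_rootScale]
    exact pow_nsmul_rootVec p a i j)
  closure_eq_top := by
    rw [← AddSubmonoid.closure_closure_coe_preimage]
    congr 1
    ext x
    simp [rootGen, Subtype.ext_iff]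

end Charts

/-! ### More on supported power series -/

namespace supportedPowerSeries

variable {σ : Type*} {N : AddSubmonoid (σ →₀ ℕ)} {S S' : Type*} [CommRing S] [CommRing S']

theorem coeff_zero_algebraMap (c : S) :
    coeff 0 (algebraMap S (supportedPowerSeries N S) c) = c := by
  rw [Algebra.algebraMap_eq_smul_one, map_smul, coeff_def, OneMemClass.coe_one,
    MvPowerSeries.coeff_zero_one, smul_eq_mul, mul_one]

theorem algebraMap_injective : Function.Injective (algebraMap S (supportedPowerSeries N S)) :=
  fun x y hxy => by rw [← coeff_zero_algebraMap (N := N) x, hxy, coeff_zero_algebraMap]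

instance instCharP (p : ℕ) [CharP S p] : CharP (supportedPowerSeries N S) p :=
  charP_of_injective_ringHom algebraMap_injective p

theorem map_algebraMap (f : S →+* S') (c : S) :
    map f (algebraMap S (supportedPowerSeries N S) c) = algebraMap S' _ (f c) := by
  refine Subtype.ext ?_
  rw [coe_expandMap, MvPowerSeries.expand_one_apply]
  change MvPowerSeries.map f (MvPowerSeries.C c) = MvPowerSeries.C (f c)
  exact MvPowerSeries.map_C _ _

theorem algebraMap_mem_nonZeroDivisors {c : S} (hc : c ∈ nonZeroDivisors S) :
    algebraMap S (supportedPowerSeries N S) c ∈ nonZeroDivisors (supportedPowerSeries N S) := by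
  rw [mem_nonZeroDivisors_iff_left]
  intro f hf
  refine ext fun h _ => ?_
  have h1 := coeff_algebraMap_mul h c f
  rw [hf, map_zero] at h1
  rw [map_zero]
  exact (mul_left_mem_nonZeroDivisors_eq_zero_iff hc).mp h1.symm

/-- The quotient by a constant is the ring of power series over the quotient. -/
def quotEquiv (c : S) : supportedPowerSeries N S ⧸
    Ideal.span {algebraMap S (supportedPowerSeries N S) c} ≃+*
      supportedPowerSeries N (S ⧸ Ideal.span {c}) :=
  (Ideal.quotEquivOfEq (ker_map (f := Ideal.Quotient.mk (Ideal.span {c})) Ideal.mk_ker).symm).trans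
    (RingHom.quotientKerEquivOfSurjective (map_surjective Ideal.Quotient.mk_surjective))

theorem quotEquiv_mk (c : S) (x : supportedPowerSeries N S) :
    quotEquiv c (Ideal.Quotient.mk _ x) = map (Ideal.Quotient.mk _) x := rfl

/-- Power series with supported power series as coefficients are supported power series with
power series as coefficients. -/
def powerSeriesEquiv : PowerSeries (supportedPowerSeries N S) ≃+*
    supportedPowerSeries N (PowerSeries S) where
  toFun F := ofFun fun h => PowerSeries.mk fun d => coeff h (PowerSeries.coeff d F)
  invFun G := PowerSeries.mk fun d => ofFun fun h => PowerSeries.coeff d (coeff h G)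
  left_inv F := by
    ext d : 1
    refine ext fun h hh => ?_
    rw [PowerSeries.coeff_mk, coeff_ofFun hh, coeff_ofFun hh, PowerSeries.coeff_mk]
  right_inv G := by
    refine ext fun h hh => ?_
    ext d
    rw [coeff_ofFun hh, PowerSeries.coeff_mk, PowerSeries.coeff_mk, coeff_ofFun hh]
  map_add' F G := by
    refine ext fun h hh => ?_
    ext d
    rw [map_add, coeff_ofFun hh, coeff_ofFun hh, coeff_ofFun hh]
    simp
  map_mul' F G := by
    classical
    refine ext fun h hh => ?_
    ext d
    rw [coeff_ofFun hh, PowerSeries.coeff_mk, PowerSeries.coeff_mul, map_sum, coeff_mul, map_sum]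
    simp only [coeff_mul, PowerSeries.coeff_mul]
    rw [Finset.sum_comm]
    refine Finset.sum_congr rfl fun x _ => Finset.sum_congr rfl fun y _ => ?_
    -- The summands of an exponent in `N` need not lie in `N`, so the formula is needed for all `h`;
    -- outside `N` both sides vanish.
    have key : ∀ (h : σ →₀ ℕ) (d : ℕ) (F : PowerSeries (supportedPowerSeries N S)),
        PowerSeries.coeff d (coeff h (ofFun fun h => PowerSeries.mk fun d =>
          coeff h (PowerSeries.coeff d F) : supportedPowerSeries N (PowerSeries S))) =
            coeff h (PowerSeries.coeff d F) := by
      intro h d F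
      by_cases hh : h ∈ N
      · rw [coeff_ofFun hh, PowerSeries.coeff_mk]
      · rw [coeff_of_notMem hh, coeff_of_notMem hh, map_zero]
    rw [key, key]

end supportedPowerSeries

/-! ### Delta structures from Frobenius lifts -/

/-- The map `δ(x) = (φ(x) - x^p)/p` is determined because `p` is a nonzerodivisor. After
multiplication by `p`, its axioms say that `φ` is a ring homomorphism. -/
theorem exists_deltaStructure {A : Type*} [CommRing A] (p : ℕ) [hp : Fact p.Prime]
    (hA : (p : A) ∈ nonZeroDivisors A) (φ : A →+* A) (hφ : ∀ x, (p : A) ∣ φ x - x ^ p) :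
    ∃ D : DeltaStructure p A, ∀ x, φ x = x ^ p + (p : A) * D.delta x := by
  choose δ hδ using hφ
  have key : ∀ x, (p : A) * δ x = φ x - x ^ p := fun x => (hδ x).symm
  have cancel : ∀ x y : A, (p : A) * x = p * y → x = y := fun x y h =>
    (mul_cancel_left_mem_nonZeroDivisors hA).mp h
  refine ⟨⟨δ, cancel _ _ ?_, cancel _ _ ?_, fun x y => cancel _ _ ?_, fun x y => cancel _ _ ?_⟩,
    fun x => ?_⟩
  · rw [key, map_zero, zero_pow hp.out.ne_zero, sub_zero, mul_zero]
  · rw [key, map_one, one_pow, sub_self, mul_zero]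
  · have h1 : ∑ k ∈ Finset.Ioo 0 p, ((p.choose k / p : ℕ) : A) * x ^ k * y ^ (p - k) =
        ∑ k ∈ Finset.Ioo 0 p, x ^ k * y ^ (p - k) * ((p.choose k / p : ℕ) : A) :=
      Finset.sum_congr rfl fun k _ => by ring
    rw [key, mul_sub, mul_add, key, key, map_add, add_pow_prime_eq' hp.out, h1]
    ring
  · have h1 : (p : A) * (x ^ p * δ y + y ^ p * δ x + p * δ x * δ y) =
        x ^ p * (p * δ y) + y ^ p * (p * δ x) + p * δ x * (p * δ y) := by ring
    rw [h1, key, key, key, map_mul, mul_pow]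
    ring
  · rw [key]
    ring

/-! ### Completed semigroup rings -/

theorem natCast_mem_nonZeroDivisors_of_ringEquiv {A B : Type*} [CommRing A] [CommRing B]
    (e : A ≃+* B) {p : ℕ} (hp : (p : B) ∈ nonZeroDivisors B) : (p : A) ∈ nonZeroDivisors A := by
  rw [mem_nonZeroDivisors_iff_left]
  intro x hx
  have h1 := congrArg e hx
  rw [map_mul, map_natCast, map_zero] at h1
  exact (map_eq_zero_iff e e.injective).mp ((mul_left_mem_nonZeroDivisors_eq_zero_iff hp).mp h1)

namespace SemigroupChart

open supportedPowerSeries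

variable {n r : ℕ} {M : Type*} [AddCommMonoid M] {a : Fin r → Fin n →₀ ℕ} {g : Fin r → M}
  (φ : SemigroupChart a g) {S : Type*} [CommRing S]

include φ in
theorem isAdicComplete (ha : ∀ j, a j ≠ 0) (p : ℕ)
    (hS : IsAdicComplete (Ideal.span {(p : S)}) S) :
    IsAdicComplete (Ideal.span {(p : CompletedSemigroupRing p S g)})
      (CompletedSemigroupRing p S g) := by
  rw [← IsAdicComplete.congr_ringEquiv _ (φ.equiv ha p hS), Ideal.map_span, Set.image_singleton,
    map_natCast, ← map_natCast (algebraMap S _)]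
  exact supportedPowerSeries.isAdicComplete _ hS

include φ in
theorem natCast_mem_nonZeroDivisors (ha : ∀ j, a j ≠ 0) (p : ℕ)
    (hS : IsAdicComplete (Ideal.span {(p : S)}) S) (hp : (p : S) ∈ nonZeroDivisors S) :
    (p : CompletedSemigroupRing p S g) ∈ nonZeroDivisors (CompletedSemigroupRing p S g) := by
  refine natCast_mem_nonZeroDivisors_of_ringEquiv (φ.equiv ha p hS) ?_
  rw [← map_natCast (algebraMap S _)]
  exact algebraMap_mem_nonZeroDivisors hp

theorem ker_map_comp_equiv (ha : ∀ j, a j ≠ 0) (p : ℕ)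
    (hS : IsAdicComplete (Ideal.span {(p : S)}) S) {S' : Type*} [CommRing S'] {f : S →+* S'}
    (hf : RingHom.ker f = Ideal.span {(p : S)}) :
    RingHom.ker ((supportedPowerSeries.map f).comp (φ.equiv ha p hS).toRingHom) =
      Ideal.span {(p : CompletedSemigroupRing p S g)} := by
  rw [← RingHom.comap_ker, ker_map hf, map_natCast]
  ext x
  rw [Ideal.mem_comap, Ideal.mem_span_singleton, Ideal.mem_span_singleton,
    ← map_natCast (φ.equiv ha p hS)]
  exact map_dvd_iff (φ.equiv ha p hS)

end SemigroupChart

/-- A zero generator contributes `t^0 = 1` to the ideal, and completion at the unit ideal gives the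
zero ring. -/
theorem subsingleton_completedSemigroupRing {r : ℕ} {M : Type*} [AddCommMonoid M] (p : ℕ)
    (S : Type*) [CommRing S] {g : Fin r → M} {j : Fin r} (hj : g j = 0) :
    Subsingleton (CompletedSemigroupRing p S g) := by
  have htop : semigroupIdeal p S g = ⊤ := by
    rw [Ideal.eq_top_iff_one]
    refine Ideal.subset_span (Or.inr ⟨j, ?_⟩)
    change AddMonoidAlgebra.single (g j) (1 : S) = 1
    rw [hj]
    rfl
  refine ⟨fun x y => AdicCompletion.ext_evalₐ fun k => ?_⟩
  have : Subsingleton (AddMonoidAlgebra S M ⧸ semigroupIdeal p S g ^ k) := by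
    rw [htop, Ideal.top_pow]
    infer_instance
  exact Subsingleton.elim _ _

/-! ### The tower of completed semigroup rings -/

section Tower

open supportedPowerSeries

variable {p : ℕ} [hp : Fact p.Prime] {n r : ℕ} {a : Fin r → Fin n →₀ ℕ}

theorem isAdicComplete_zmod : IsAdicComplete (Ideal.span {(p : ZMod p)}) (ZMod p) := by
  rw [CharP.cast_eq_zero, Ideal.span_singleton_zero]
  infer_instance

/-- The ring `K[[X]]` is integrally closed, so divisibility of `k`-th powers descends. -/
theorem PowerSeries.X_pow_dvd_of_pow_dvd {K : Type*} [Field K] {m k : ℕ} (hk : k ≠ 0)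
    {y : PowerSeries K} (h : PowerSeries.X ^ (m * k) ∣ y ^ k) : PowerSeries.X ^ m ∣ y := by
  rw [pow_mul] at h
  exact (IsIntegrallyClosed.pow_dvd_pow_iff hk).mp h

/-- The quotient of the power series ring over `𝔽_p[[X]]` by a power of `X`. -/
def truncEquiv (p : ℕ) [Fact p.Prime] (a : Fin r → Fin n →₀ ℕ) (N : ℕ) :
    supportedPowerSeries (affineSemigroup a) (PowerSeries (ZMod p)) ⧸ Ideal.span
      {(algebraMap (PowerSeries (ZMod p))
        (supportedPowerSeries (affineSemigroup a) (PowerSeries (ZMod p))) PowerSeries.X) ^ N} ≃+*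
    supportedPowerSeries (affineSemigroup a)
      (PowerSeries (ZMod p) ⧸ Ideal.span {(PowerSeries.X : PowerSeries (ZMod p)) ^ N}) :=
  (Ideal.quotEquivOfEq (by rw [map_pow])).trans
    (supportedPowerSeries.quotEquiv (PowerSeries.X ^ N : PowerSeries (ZMod p)))

theorem truncEquiv_mk (N : ℕ)
    (y : supportedPowerSeries (affineSemigroup a) (PowerSeries (ZMod p))) :
    truncEquiv p a N (Ideal.Quotient.mk _ y) = supportedPowerSeries.map (Ideal.Quotient.mk _) y :=
  rfl

theorem expandMap_truncFrobenius {N N' : ℕ} (hN : N' = N * p)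
    (y : supportedPowerSeries (affineSemigroup a) (PowerSeries (ZMod p))) :
    expandMap p hp.out.ne_zero (truncFrobenius p hN)
      (supportedPowerSeries.map (Ideal.Quotient.mk _) y) =
        supportedPowerSeries.map (Ideal.Quotient.mk _) (y ^ p) := by
  rw [← expandMap_expandMap', ← expandMap_frobenius p y, ← expandMap_expandMap]
  rfl

variable (ϖ : ℕ → AlgebraicClosure ℚ_[p]) (hϖ₀ : ϖ 0 = (p : AlgebraicClosure ℚ_[p]))
  (hϖ : ∀ i, ϖ (i + 1) ^ p = ϖ i)

include hϖ₀ hϖ in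
theorem pow_root_eq (i : ℕ) : ϖ i ^ p ^ i = (p : AlgebraicClosure ℚ_[p]) := by
  induction i with
  | zero => rw [pow_zero, pow_one, hϖ₀]
  | succ i ih => rw [pow_succ', pow_mul, hϖ, ih]

theorem prime_pow_ne_zero (i : ℕ) : p ^ i ≠ 0 := pow_ne_zero i hp.out.ne_zero

theorem isAdicComplete_rootRing (i : ℕ) (hw : ϖ i ^ p ^ i = (p : AlgebraicClosure ℚ_[p])) :
    IsAdicComplete (Ideal.span {(p : rootRing p ϖ i)}) (rootRing p ϖ i) :=
  isAdicComplete_adjoin (prime_pow_ne_zero i) hw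

/-- The terms of the tower as rings of power series. -/
def towerEquiv (ha : ∀ j, a j ≠ 0) (i : ℕ) :
    (semigroupTower p a ϖ hϖ).obj i ≃+*
      supportedPowerSeries (affineSemigroup a) (rootRing p ϖ i) :=
  (rootChart p a i).equiv ha p (isAdicComplete_rootRing ϖ i (pow_root_eq ϖ hϖ₀ hϖ i))

theorem towerEquiv_map (ha : ∀ j, a j ≠ 0) (i : ℕ) (x : (semigroupTower p a ϖ hϖ).obj i) :
    towerEquiv ϖ hϖ₀ hϖ ha (i + 1) ((semigroupTower p a ϖ hϖ).map i x) =
      expandMap p hp.out.ne_zero (Subalgebra.inclusion (rootRing_le p ϖ hϖ i)).toRingHom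
        (towerEquiv ϖ hϖ₀ hϖ ha i x) :=
  (rootChart p a i).equiv_completedSemigroupRingMap (rootChart p a (i + 1)) ha p _ _ _ _ _
    (fun j => Subtype.ext (rootVec_succ p a i j)) x

/-- The reduction of the coefficient rings of the tower. -/
def rootRingReduction (i : ℕ) : rootRing p ϖ i →+* PowerSeries (ZMod p) ⧸
    Ideal.span {(PowerSeries.X : PowerSeries (ZMod p)) ^ p ^ i} :=
  adjoinReduction (prime_pow_ne_zero i) (pow_root_eq ϖ hϖ₀ hϖ i)

/-- The reduction of the terms of the tower. -/
def towerReduction (ha : ∀ j, a j ≠ 0) (i : ℕ) :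
    (semigroupTower p a ϖ hϖ).obj i →+*
      supportedPowerSeries (affineSemigroup a) (PowerSeries (ZMod p)) ⧸ Ideal.span
        {(algebraMap (PowerSeries (ZMod p))
          (supportedPowerSeries (affineSemigroup a) (PowerSeries (ZMod p))) PowerSeries.X)
            ^ p ^ i} :=
  (truncEquiv p a (p ^ i)).symm.toRingHom.comp
    ((supportedPowerSeries.map (rootRingReduction ϖ hϖ₀ hϖ i)).comp
      (towerEquiv ϖ hϖ₀ hϖ ha i).toRingHom)

theorem towerReduction_eq_mk_iff (ha : ∀ j, a j ≠ 0) (i : ℕ)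
    (x : (semigroupTower p a ϖ hϖ).obj i)
    (y : supportedPowerSeries (affineSemigroup a) (PowerSeries (ZMod p))) :
    towerReduction ϖ hϖ₀ hϖ ha i x = Ideal.Quotient.mk _ y ↔
      supportedPowerSeries.map (rootRingReduction ϖ hϖ₀ hϖ i) (towerEquiv ϖ hϖ₀ hϖ ha i x) =
        supportedPowerSeries.map (Ideal.Quotient.mk _) y := by
  rw [← truncEquiv_mk]
  exact (truncEquiv p a (p ^ i)).symm_apply_eq

/-- Modulo `p` the coefficients undergo the truncated Frobenius and the exponents are multiplied by
`p`; together these form the Frobenius of the power series ring. -/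
theorem towerReduction_map (ha : ∀ j, a j ≠ 0) (i : ℕ) (x : (semigroupTower p a ϖ hϖ).obj i)
    (y : supportedPowerSeries (affineSemigroup a) (PowerSeries (ZMod p)))
    (h : towerReduction ϖ hϖ₀ hϖ ha i x = Ideal.Quotient.mk _ y) :
    towerReduction ϖ hϖ₀ hϖ ha (i + 1) ((semigroupTower p a ϖ hϖ).map i x) =
      Ideal.Quotient.mk _ (y ^ p) := by
  rw [towerReduction_eq_mk_iff] at h ⊢
  rw [towerEquiv_map, ← expandMap_expandMap]
  have h1 : (rootRingReduction ϖ hϖ₀ hϖ (i + 1)).comp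
      (Subalgebra.inclusion (rootRing_le p ϖ hϖ i)).toRingHom =
        (truncFrobenius p (pow_succ p i)).comp (rootRingReduction ϖ hϖ₀ hϖ i) :=
    adjoinReduction_inclusion _ _ _ _ (pow_succ p i) (hϖ i) _
  rw [h1, expandMap_expandMap', h, expandMap_truncFrobenius]

theorem natCast_mem_nonZeroDivisors_rootRing (i : ℕ) :
    (p : rootRing p ϖ i) ∈ nonZeroDivisors (rootRing p ϖ i) := by
  refine mem_nonZeroDivisors_of_ne_zero fun h => ?_
  have h1 : ((p : rootRing p ϖ i) : AlgebraicClosure ℚ_[p]) = 0 := by rw [h]; rfl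
  exact hp.out.ne_zero (Nat.cast_eq_zero.mp h1)

/-- The chosen root `p^{1/p^i}`. -/
def rootRingGen (i : ℕ) : rootRing p ϖ i :=
  ⟨ϖ i, Algebra.self_mem_adjoin_singleton ℤ_[p] (ϖ i)⟩

/-- The reductions of the tower of completed semigroup rings are truncations of a power series
ring over `𝔽_p[[X]]`. -/
def semigroupTowerModel (ha : ∀ j, a j ≠ 0) :
    RingTower.FrobeniusModel p (semigroupTower p a ϖ hϖ)
      (supportedPowerSeries (affineSemigroup a) (PowerSeries (ZMod p)))
      (algebraMap (PowerSeries (ZMod p)) _ PowerSeries.X) where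
  p_eq_zero := CharP.cast_eq_zero _ p
  complete := supportedPowerSeries.isAdicComplete _ inferInstance
  dvd_of_dvd_pow m y h := by
    rw [← map_pow, algebraMap_dvd_iff] at h ⊢
    intro l
    -- The coefficient of `y^p` at `p • l` is the `p`-th power of the coefficient of `y` at `l`,
    -- which reduces the claim to `𝔽_p[[X]]`.
    refine PowerSeries.X_pow_dvd_of_pow_dvd hp.out.ne_zero ?_
    have := h (p • l)
    rwa [← expandMap_frobenius, coeff_expandMap_smul] at this
  red i := towerReduction ϖ hϖ₀ hϖ ha i
  red_surjective i :=
    (truncEquiv p a (p ^ i)).symm.surjective.comp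
      ((map_surjective (adjoinReduction_surjective _ _)).comp
        (towerEquiv ϖ hϖ₀ hϖ ha i).surjective)
  ker_red i := by
    have h1 := (rootChart p a i).ker_map_comp_equiv ha p
      (isAdicComplete_rootRing ϖ i (pow_root_eq ϖ hϖ₀ hϖ i))
      (ker_adjoinReduction (prime_pow_ne_zero i) (pow_root_eq ϖ hϖ₀ hϖ i))
    refine Eq.trans ?_ h1
    ext x
    change (truncEquiv p a (p ^ i)).symm (supportedPowerSeries.map (rootRingReduction ϖ hϖ₀ hϖ i)
      (towerEquiv ϖ hϖ₀ hϖ ha i x)) = 0 ↔ supportedPowerSeries.map (rootRingReduction ϖ hϖ₀ hϖ i)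
        (towerEquiv ϖ hϖ₀ hϖ ha i x) = 0
    exact map_eq_zero_iff (truncEquiv p a (p ^ i)).symm (RingEquiv.injective _)
  red_map := towerReduction_map ϖ hϖ₀ hϖ ha
  root := (towerEquiv ϖ hϖ₀ hϖ ha 1).symm
    (algebraMap (rootRing p ϖ 1) _ (rootRingGen ϖ 1))
  root_pow := by
    rw [← map_pow, RingEquiv.symm_apply_eq, map_natCast, ← map_pow,
      ← map_natCast (algebraMap (rootRing p ϖ 1) _)]
    refine congrArg _ (Subtype.ext ?_)
    exact (hϖ 0).trans hϖ₀
  red_root := by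
    rw [towerReduction_eq_mk_iff, RingEquiv.apply_symm_apply, map_algebraMap, map_algebraMap]
    refine congrArg _ ?_
    have h1 := adjoinReduction_evalAdjoin (prime_pow_ne_zero 1) (pow_root_eq ϖ hϖ₀ hϖ 1)
      Polynomial.X
    have h2 : evalAdjoin (ϖ 1) Polynomial.X =
        rootRingGen ϖ 1 := Polynomial.aeval_X _
    rw [h2] at h1
    refine h1.trans ?_
    change Ideal.Quotient.mk _ ((Polynomial.X.map PadicInt.toZMod : Polynomial (ZMod p)) :
      PowerSeries (ZMod p)) = _
    rw [Polynomial.map_X, Polynomial.coe_X]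
  zariskian i :=
    @IsAdicComplete.le_jacobson_bot _ _ _ ((rootChart p a i).isAdicComplete ha p
      (isAdicComplete_rootRing ϖ i (pow_root_eq ϖ hϖ₀ hϖ i)))
  p_mem i := (rootChart p a i).natCast_mem_nonZeroDivisors ha p
    (isAdicComplete_rootRing ϖ i (pow_root_eq ϖ hϖ₀ hϖ i))
    (natCast_mem_nonZeroDivisors_rootRing ϖ i)

theorem algebraMap_rootRing_bijective (hϖ₀ : ϖ 0 = (p : AlgebraicClosure ℚ_[p])) :
    Function.Bijective (algebraMap ℤ_[p] (rootRing p ϖ 0)) := by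
  constructor
  · exact FaithfulSMul.algebraMap_injective _ _
  · rintro ⟨x, hx⟩
    have h1 : rootRing p ϖ 0 ≤ ⊥ := by
      refine Algebra.adjoin_le (Set.singleton_subset_iff.mpr ?_)
      rw [hϖ₀]
      exact natCast_mem (⊥ : Subalgebra ℤ_[p] (AlgebraicClosure ℚ_[p])) p
    obtain ⟨c, hc⟩ := Algebra.mem_bot.mp (h1 hx)
    exact ⟨c, Subtype.ext hc⟩

include hϖ₀ in
theorem semigroupTowerBase_bijective (ha : ∀ j, a j ≠ 0) :
    Function.Bijective (semigroupTowerBase p a ϖ hϖ) := by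
  have h1 : ∀ x, towerEquiv ϖ hϖ₀ hϖ ha 0 (semigroupTowerBase p a ϖ hϖ x) =
      supportedPowerSeries.map (algebraMap ℤ_[p] (rootRing p ϖ 0))
        ((affineChart a).equiv ha p PadicInt.isAdicComplete_span_p x) :=
    (affineChart a).equiv_completedSemigroupRingMap (rootChart p a 0) ha p _ _ _ _ _ _
  have h2 := algebraMap_rootRing_bijective ϖ hϖ₀
  have h3 : Function.Bijective (supportedPowerSeries.map (N := affineSemigroup a)
      (algebraMap ℤ_[p] (rootRing p ϖ 0))) :=
    ⟨expandMap_injective 1 one_ne_zero h2.1, map_surjective h2.2⟩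
  have h4 : Function.Bijective ((towerEquiv ϖ hϖ₀ hϖ ha 0) ∘ (semigroupTowerBase p a ϖ hϖ)) := by
    rw [show (towerEquiv ϖ hϖ₀ hϖ ha 0) ∘ (semigroupTowerBase p a ϖ hϖ) = _ from funext h1]
    exact h3.comp (RingEquiv.bijective _)
  exact ((towerEquiv ϖ hϖ₀ hϖ ha 0).bijective.of_comp_iff' _).mp h4

include hϖ₀ in
theorem semigroupTower_map_injective (ha : ∀ j, a j ≠ 0) (i : ℕ) :
    Function.Injective ((semigroupTower p a ϖ hϖ).map i) := by
  intro x y hxy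
  have h1 := congrArg (towerEquiv ϖ hϖ₀ hϖ ha (i + 1)) hxy
  rw [towerEquiv_map, towerEquiv_map] at h1
  exact (towerEquiv ϖ hϖ₀ hϖ ha i).injective
    (expandMap_injective p hp.out.ne_zero (Subalgebra.inclusion_injective _) h1)

/-- The terms of the tower in characteristic `p` as rings of power series over `𝔽_p[[X]]`. -/
def charPTowerEquiv (ha : ∀ j, a j ≠ 0) (i : ℕ) : (charPTower p a).obj i ≃+*
    supportedPowerSeries (affineSemigroup a) (PowerSeries (ZMod p)) :=
  (RingEquiv.ofBijective
    (PowerSeries.map ((rootChart p a i).equiv ha p isAdicComplete_zmod).toRingHom)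
    ⟨PowerSeries.map_injective _ (RingEquiv.injective _),
      PowerSeries.map_surjective _ (RingEquiv.surjective _)⟩).trans powerSeriesEquiv

theorem PowerSeries.expand_map_frobenius {S : Type*} [CommRing S] [CharP S p]
    (x : PowerSeries S) :
    PowerSeries.expand p hp.out.ne_zero (PowerSeries.map (frobenius S p) x) = x ^ p := by
  rw [← PowerSeries.map_expand]
  exact MvPowerSeries.map_frobenius_expand p hp.out.ne_zero

theorem PowerSeries.map_expand_map {A B C : Type*} [CommRing A] [CommRing B] [CommRing C]
    [CharP C p] (f : A →+* B) (g : A →+* C) (g' : B →+* C) (h : ∀ y, g' (f y) = g y ^ p)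
    (x : PowerSeries A) :
    PowerSeries.map g' (PowerSeries.expand p hp.out.ne_zero (PowerSeries.map f x)) =
      PowerSeries.map g x ^ p := by
  rw [← PowerSeries.expand_map_frobenius, PowerSeries.map_expand]
  congr 1
  ext d
  simp only [PowerSeries.coeff_map, h, frobenius_def]

/-- In the charts the transition map sends `t^h` to `t^{ph}` and `T` to `T^p` and fixes `𝔽_p`, so it
is the Frobenius. -/
theorem charPTowerEquiv_map (ha : ∀ j, a j ≠ 0) (i : ℕ) (x : (charPTower p a).obj i) :
    charPTowerEquiv ha (i + 1) ((charPTower p a).map i x) = charPTowerEquiv ha i x ^ p := by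
  have h1 := PowerSeries.map_expand_map (charPMap p a i)
    ((rootChart p a i).equiv ha p isAdicComplete_zmod).toRingHom
    ((rootChart p a (i + 1)).equiv ha p isAdicComplete_zmod).toRingHom (fun y =>
      ((rootChart p a i).equiv_completedSemigroupRingMap (rootChart p a (i + 1)) ha p
        isAdicComplete_zmod isAdicComplete_zmod _ _ _
        (fun j => Subtype.ext (rootVec_succ p a i j)) y).trans (expandMap_id_zmod p _)) x
  exact (congrArg powerSeriesEquiv h1).trans (map_pow _ _ _)

theorem charPTower_map_injective (ha : ∀ j, a j ≠ 0) (i : ℕ) :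
    Function.Injective ((charPTower p a).map i) := by
  intro x y hxy
  have h1 := congrArg (charPTowerEquiv ha (i + 1)) hxy
  rw [charPTowerEquiv_map, charPTowerEquiv_map] at h1
  exact (charPTowerEquiv ha i).injective (frobenius_inj _ p h1)

end Tower

/-! ### The affine semigroup ring -/

section SemigroupRing

variable {n r : ℕ}

theorem semigroupToPolynomial_injective (S : Type*) [CommRing S] (a : Fin r → Fin n →₀ ℕ) :
    Function.Injective (semigroupToPolynomial S a) :=
  AddMonoidAlgebra.mapDomain_injective Subtype.val_injective

theorem semigroupToPolynomial_single (S : Type*) [CommRing S] (a : Fin r → Fin n →₀ ℕ)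
    (h : affineSemigroup a) (c : S) :
    semigroupToPolynomial S a (AddMonoidAlgebra.single h c) = MvPolynomial.monomial h.1 c :=
  AddMonoidAlgebra.mapDomain_single

theorem semigroupToPolynomial_range (S : Type*) [CommRing S] (a : Fin r → Fin n →₀ ℕ) :
    (semigroupToPolynomial S a).range =
      Algebra.adjoin S (Set.range fun j => MvPolynomial.monomial (a j) (1 : S)) := by
  apply le_antisymm
  · rintro _ ⟨x, rfl⟩
    change semigroupToPolynomial S a x ∈ _
    rw [← AddMonoidAlgebra.sum_coeff_single x, Finsupp.sum, map_sum]
    refine sum_mem fun h hmem => ?_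
    clear hmem
    rw [semigroupToPolynomial_single, ← mul_one (x.coeff h), ← smul_eq_mul,
      ← MvPolynomial.smul_monomial]
    refine Subalgebra.smul_mem _ ?_ _
    obtain ⟨h, hh⟩ := h
    induction hh using AddSubmonoid.closure_induction with
    | mem y hy =>
      obtain ⟨j, rfl⟩ := hy
      exact Algebra.subset_adjoin ⟨j, rfl⟩
    | zero => exact one_mem _
    | add y z _ _ hy hz =>
      have := mul_mem hy hz
      rwa [MvPolynomial.monomial_mul, one_mul] at this
  · refine Algebra.adjoin_le ?_
    rintro _ ⟨j, rfl⟩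
    exact ⟨AddMonoidAlgebra.single (affineGen a j) 1, semigroupToPolynomial_single S a _ _⟩

theorem AddMonoidAlgebra.natCast_mem_nonZeroDivisors {S M : Type*} [CommRing S] [AddCommMonoid M]
    {p : ℕ} (hp : (p : S) ∈ nonZeroDivisors S) :
    (p : AddMonoidAlgebra S M) ∈ nonZeroDivisors (AddMonoidAlgebra S M) := by
  rw [mem_nonZeroDivisors_iff_left]
  intro x hx
  rw [AddMonoidAlgebra.natCast_def] at hx
  refine AddMonoidAlgebra.ext (Finsupp.ext fun m => ?_)
  have h1 := AddMonoidAlgebra.coeff_single_zero_mul x (p : S) m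
  rw [hx] at h1
  exact (mul_left_mem_nonZeroDivisors_eq_zero_iff hp).mp h1.symm

theorem PadicInt.dvd_sub_pow (p : ℕ) [hp : Fact p.Prime] (c : ℤ_[p]) :
    (p : ℤ_[p]) ∣ c - c ^ p := by
  rw [← PadicInt.toZMod_eq_zero_iff, map_sub, map_pow, ZMod.pow_card, sub_self]

/-- The `p`-th power map is additive modulo `p`, which leaves the monomials: `c t^{pm}` and `c^p
t^{pm}` are congruent because `p` divides `c - c^p` in `ℤ_p`. -/
theorem semigroupRingMap_sub_pow_mem (p : ℕ) [hp : Fact p.Prime] {M : Type*} [AddCommMonoid M]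
    (x : AddMonoidAlgebra ℤ_[p] M) :
    semigroupRingMap (RingHom.id _) (nsmulAddMonoidHom p) x - x ^ p ∈
      Ideal.span {(p : AddMonoidAlgebra ℤ_[p] M)} := by
  have hsum : ∀ (s : Finset M) (f : M → AddMonoidAlgebra ℤ_[p] M),
      (∑ m ∈ s, f m) ^ p - ∑ m ∈ s, f m ^ p ∈ Ideal.span {(p : AddMonoidAlgebra ℤ_[p] M)} := by
    classical
    intro s f
    induction s using Finset.induction_on with
    | empty => simp [hp.out.ne_zero]
    | insert m s hm ih =>
      rw [Finset.sum_insert hm, Finset.sum_insert hm]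
      obtain ⟨c, hc⟩ := exists_add_pow_prime_eq hp.out (f m) (∑ m ∈ s, f m)
      have h1 : (f m + ∑ m ∈ s, f m) ^ p - (f m ^ p + ∑ m ∈ s, f m ^ p) =
          ((∑ m ∈ s, f m) ^ p - ∑ m ∈ s, f m ^ p) + p * (f m * (∑ m ∈ s, f m) * c) := by
        rw [hc]
        ring
      rw [h1]
      exact add_mem ih (Ideal.mul_mem_right _ _ (Ideal.mem_span_singleton_self _))
  have h1 := hsum x.coeff.support fun m => AddMonoidAlgebra.single m (x.coeff m)
  have h2 : ∑ m ∈ x.coeff.support, AddMonoidAlgebra.single m (x.coeff m) = x :=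
    AddMonoidAlgebra.sum_coeff_single x
  rw [h2] at h1
  have h3 : semigroupRingMap (RingHom.id _) (nsmulAddMonoidHom p) x -
      ∑ m ∈ x.coeff.support, AddMonoidAlgebra.single m (x.coeff m) ^ p ∈
        Ideal.span {(p : AddMonoidAlgebra ℤ_[p] M)} := by
    nth_rw 1 [← h2]
    rw [map_sum, ← Finset.sum_sub_distrib]
    refine sum_mem fun m _ => ?_
    rw [semigroupRingMap_single, AddMonoidAlgebra.single_pow, RingHom.id_apply]
    change AddMonoidAlgebra.single (p • m) _ - AddMonoidAlgebra.single (p • m) _ ∈ _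
    rw [← AddMonoidAlgebra.single_sub, Ideal.mem_span_singleton]
    obtain ⟨d, hd⟩ := PadicInt.dvd_sub_pow p (x.coeff m)
    refine ⟨AddMonoidAlgebra.single (p • m) d, ?_⟩
    rw [hd, AddMonoidAlgebra.natCast_def, AddMonoidAlgebra.single_mul_single, zero_add]
  have h4 := sub_mem h3 h1
  rwa [sub_sub_sub_cancel_right] at h4

theorem finiteType_semigroupRing (S : Type*) [CommRing S] (a : Fin r → Fin n →₀ ℕ) :
    Algebra.FiniteType S (AddMonoidAlgebra S (affineSemigroup a)) := by
  have : AddMonoid.FG (affineSemigroup a) :=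
    (AddMonoid.fg_iff_addSubmonoid_fg _).mpr
      ((AddSubmonoid.fg_iff _).mpr ⟨_, rfl, Set.finite_range a⟩)
  infer_instance

end SemigroupRing

/-! ### The completed semigroup ring over the `p`-adic integers -/

section CompletedRing

open supportedPowerSeries

variable {p : ℕ} [hp : Fact p.Prime] {n r : ℕ} {a : Fin r → Fin n →₀ ℕ}

theorem PadicInt.natCast_mem_nonZeroDivisors : (p : ℤ_[p]) ∈ nonZeroDivisors ℤ_[p] :=
  mem_nonZeroDivisors_of_ne_zero (Nat.cast_ne_zero.mpr hp.out.ne_zero)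

theorem PadicInt.ker_toZMod_eq_span :
    RingHom.ker (PadicInt.toZMod (p := p)) = Ideal.span {(p : ℤ_[p])} :=
  PadicInt.ker_toZMod.trans PadicInt.maximalIdeal_eq_span_p

/-- The reduction of `ℤ_p[[H]]` modulo `p`. -/
def zpReduction (ha : ∀ j, a j ≠ 0) :
    ZpH p a →+* supportedPowerSeries (affineSemigroup a) (ZMod p) :=
  (supportedPowerSeries.map PadicInt.toZMod).comp
    ((affineChart a).equiv ha p PadicInt.isAdicComplete_span_p).toRingHom

theorem ker_zpReduction (ha : ∀ j, a j ≠ 0) :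
    RingHom.ker (zpReduction ha) = Ideal.span {(p : ZpH p a)} :=
  (affineChart a).ker_map_comp_equiv ha p _ PadicInt.ker_toZMod_eq_span

theorem zpReduction_completedFrobenius (ha : ∀ j, a j ≠ 0) (x : ZpH p a) :
    zpReduction ha (completedFrobenius p a x) = zpReduction ha x ^ p := by
  have h1 := (affineChart a).equiv_completedSemigroupRingMap (affineChart a) ha p
    PadicInt.isAdicComplete_span_p PadicInt.isAdicComplete_span_p (RingHom.id _)
    (nsmulAddMonoidHom p) hp.out.ne_zero (fun _ => rfl) x
  refine (congrArg (supportedPowerSeries.map PadicInt.toZMod) h1).trans ?_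
  rw [← expandMap_expandMap, ← expandMap_id_zmod, RingHom.comp_id]
  change _ = expandMap p _ _ (supportedPowerSeries.map PadicInt.toZMod _)
  rw [← expandMap_expandMap', RingHom.id_comp]
  rfl

theorem natCast_mem_nonZeroDivisors_zpH (ha : ∀ j, a j ≠ 0) :
    (p : ZpH p a) ∈ nonZeroDivisors (ZpH p a) :=
  (affineChart a).natCast_mem_nonZeroDivisors ha p PadicInt.isAdicComplete_span_p
    PadicInt.natCast_mem_nonZeroDivisors

theorem isAdicComplete_zpH (ha : ∀ j, a j ≠ 0) :
    IsAdicComplete (Ideal.span {(p : ZpH p a)}) (ZpH p a) :=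
  (affineChart a).isAdicComplete ha p PadicInt.isAdicComplete_span_p

theorem exists_deltaStructure_zpH (ha : ∀ j, a j ≠ 0) :
    ∃ D : DeltaStructure p (ZpH p a),
      ∀ x, completedFrobenius p a x = x ^ p + (p : ZpH p a) * D.delta x := by
  refine exists_deltaStructure p (natCast_mem_nonZeroDivisors_zpH ha) _ fun x => ?_
  rw [← Ideal.mem_span_singleton, ← ker_zpReduction ha, RingHom.mem_ker, map_sub, map_pow,
    zpReduction_completedFrobenius, sub_self]

theorem isReduced_quotient_of_ker_eq {A B : Type*} [CommRing A] [CommRing B] [IsReduced B]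
    {I : Ideal A} (f : A →+* B) (hf : RingHom.ker f = I) : IsReduced (A ⧸ I) := by
  subst hf
  exact isReduced_of_injective (RingHom.kerLift f) (RingHom.kerLift_injective f)

/-- The quotient embeds into a ring of power series over the field `𝔽_p`, which is reduced. -/
theorem isReduced_zpH_quotient (ha : ∀ j, a j ≠ 0) :
    IsReduced (ZpH p a ⧸ Ideal.span {(p : ZpH p a)}) :=
  isReduced_quotient_of_ker_eq (zpReduction ha) (ker_zpReduction ha)

end CompletedRing

/-! ### The degenerate case -/

/-- The model of a tower of zero rings. -/
def RingTower.FrobeniusModel.ofSubsingleton (p : ℕ) (T : RingTower.{u})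
    (hT : ∀ i, Subsingleton (T.obj i)) :
    RingTower.FrobeniusModel p T PUnit.{1} (PUnit.unit : PUnit.{1}) where
  p_eq_zero := Subsingleton.elim _ _
  complete := inferInstance
  dvd_of_dvd_pow _ _ _ := ⟨0, Subsingleton.elim _ _⟩
  red i :=
    { toFun := fun _ => 0
      map_one' := Subsingleton.elim _ _
      map_mul' := fun _ _ => Subsingleton.elim _ _
      map_zero' := rfl
      map_add' := fun _ _ => Subsingleton.elim _ _ }
  red_surjective i y := ⟨0, Subsingleton.elim _ _⟩
  ker_red i := Subsingleton.elim _ _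
  red_map _ _ _ _ := Subsingleton.elim _ _
  root := 0
  root_pow := Subsingleton.elim _ _
  red_root := Subsingleton.elim _ _
  zariskian i := (Subsingleton.elim _ _ : _ = _).le
  p_mem i := by
    rw [mem_nonZeroDivisors_iff_left]
    exact fun _ _ => Subsingleton.elim _ _

/-- Two zero rings are isomorphic. -/
def RingEquiv.ofSubsingletons (A B : Type*) [CommRing A] [CommRing B] [Subsingleton A]
    [Subsingleton B] : A ≃+* B where
  toFun _ := 0
  invFun _ := 0
  left_inv _ := Subsingleton.elim _ _
  right_inv _ := Subsingleton.elim _ _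
  map_mul' _ _ := Subsingleton.elim _ _
  map_add' _ _ := Subsingleton.elim _ _

section Degenerate

variable {p : ℕ} {n r : ℕ} {a : Fin r → Fin n →₀ ℕ} {j : Fin r}

theorem rootGen_eq_zero (hj : a j = 0) (i : ℕ) : rootGen p a i j = 0 :=
  Subtype.ext (by
    change rootVec p a i j = 0
    rw [rootVec, hj, map_zero, smul_zero])

variable [hp : Fact p.Prime]

theorem subsingleton_zpH (hj : a j = 0) : Subsingleton (ZpH p a) :=
  subsingleton_completedSemigroupRing p _ (j := j) (Subtype.ext hj)

theorem subsingleton_semigroupTower (ϖ : ℕ → AlgebraicClosure ℚ_[p])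
    (hϖ : ∀ i, ϖ (i + 1) ^ p = ϖ i) (hj : a j = 0) (i : ℕ) :
    Subsingleton ((semigroupTower p a ϖ hϖ).obj i) :=
  subsingleton_completedSemigroupRing p _ (rootGen_eq_zero hj i)

theorem subsingleton_charPTower (hj : a j = 0) (i : ℕ) :
    Subsingleton ((charPTower p a).obj i) := by
  have := subsingleton_completedSemigroupRing p (ZMod p) (rootGen_eq_zero (p := p) hj i)
  exact (inferInstance : Subsingleton
    (PowerSeries (CompletedSemigroupRing p (ZMod p) (rootGen p a i))))

end Degenerate

end

theorem mainTheorem7 (p : ℕ) [Fact p.Prime] {n r : ℕ} (a : Fin r → Fin n →₀ ℕ)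
    (ϖ : ℕ → AlgebraicClosure ℚ_[p]) (hϖ₀ : ϖ 0 = (p : AlgebraicClosure ℚ_[p]))
    (hϖ : ∀ i, ϖ (i + 1) ^ p = ϖ i) :
    -- the affine semigroup ring
    (Function.Injective (semigroupToPolynomial ℤ_[p] a) ∧
      (semigroupToPolynomial ℤ_[p] a).range =
        Algebra.adjoin ℤ_[p] (Set.range fun j => MvPolynomial.monomial (a j) (1 : ℤ_[p])) ∧
      (p : AddMonoidAlgebra ℤ_[p] (affineSemigroup a)) ∈
        nonZeroDivisors (AddMonoidAlgebra ℤ_[p] (affineSemigroup a)) ∧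
      Algebra.FiniteType ℤ_[p] (AddMonoidAlgebra ℤ_[p] (affineSemigroup a)) ∧
      ∀ x, semigroupFrobenius p a x - x ^ p ∈
        Ideal.span {(p : AddMonoidAlgebra ℤ_[p] (affineSemigroup a))}) ∧
    -- its completion
    ((p : ZpH p a) ∈ nonZeroDivisors (ZpH p a) ∧
      (Ideal.span {(p : ZpH p a)}).IsZariskian ∧
      (∃ D : DeltaStructure p (ZpH p a),
        ∀ x, completedFrobenius p a x = x ^ p + (p : ZpH p a) * D.delta x) ∧
      IsReduced (ZpH p a ⧸ Ideal.span {(p : ZpH p a)}) ∧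
      IsHausdorff (Ideal.span {(p : ZpH p a)}) (ZpH p a)) ∧
    -- the perfectoid tower and its tilt
    (∀ i, Function.Injective ((semigroupTower p a ϖ hϖ).map i)) ∧
    (∀ i, Function.Injective ((charPTower p a).map i)) ∧
    ∃ h : RingTower.IsPerfectoid p (semigroupTower p a ϖ hϖ) (semigroupTowerBase p a ϖ hϖ)
        (Ideal.span {(p : ZpH p a)}),
      h.tilt.IsIsomorphic (charPTower p a) := by
  refine ⟨⟨semigroupToPolynomial_injective _ a, semigroupToPolynomial_range _ a,
    AddMonoidAlgebra.natCast_mem_nonZeroDivisors PadicInt.natCast_mem_nonZeroDivisors,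
    finiteType_semigroupRing _ a, semigroupRingMap_sub_pow_mem p⟩, ?_⟩
  -- Word lengths are bounded only if no generator is zero; otherwise every completion is the zero
  -- ring.
  by_cases ha : ∀ j, a j ≠ 0
  · let D := semigroupTowerModel ϖ hϖ₀ hϖ ha
    exact ⟨⟨natCast_mem_nonZeroDivisors_zpH ha,
      @IsAdicComplete.le_jacobson_bot _ _ _ (isAdicComplete_zpH ha), exists_deltaStructure_zpH ha,
      isReduced_zpH_quotient ha, (isAdicComplete_zpH ha).toIsHausdorff⟩,
      semigroupTower_map_injective ϖ hϖ₀ hϖ ha, charPTower_map_injective ha,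
      D.isPerfectoid (semigroupTowerBase_bijective ϖ hϖ₀ hϖ ha),
      D.tilt_isIsomorphic _ _ (charPTowerEquiv ha) (charPTowerEquiv_map ha)⟩
  · push Not at ha
    obtain ⟨j, hj⟩ := ha
    have h1 : Subsingleton (ZpH p a) := subsingleton_zpH hj
    have h2 := subsingleton_semigroupTower ϖ hϖ hj
    have h3 : ∀ i, Subsingleton ((charPTower p a).obj i) := subsingleton_charPTower hj
    let D := RingTower.FrobeniusModel.ofSubsingleton p _ h2
    have hbij : Function.Bijective (semigroupTowerBase p a ϖ hϖ) :=
      ⟨fun _ _ _ => Subsingleton.elim _ _, fun y => ⟨0, Subsingleton.elim _ y⟩⟩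
    have hp0 : (p : ZpH p a) ∈ nonZeroDivisors (ZpH p a) := by
      rw [mem_nonZeroDivisors_iff_left]
      exact fun _ _ => Subsingleton.elim _ _
    exact ⟨⟨hp0, (Subsingleton.elim _ _ : _ = _).le,
      exists_deltaStructure p hp0 _ fun x => ⟨0, Subsingleton.elim _ _⟩,
      ⟨fun x _ => Subsingleton.elim _ _⟩, ⟨fun x _ => Subsingleton.elim _ _⟩⟩,
      fun i _ _ _ => (h2 i).elim _ _, fun i _ _ _ => (h3 i).elim _ _,
      D.isPerfectoid hbij,
      D.tilt_isIsomorphic _ _ (fun i => RingEquiv.ofSubsingletons _ _)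
        fun i x => Subsingleton.elim _ _⟩
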